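/- Fix a two-tier network (tier 1 macro, tier 2 pico) with antenna numbers $N_1,N_2\ge1$, base station densities $\lambda_1,\lambda_2>0$, user density $\lambda_u>0$, transmit powers $P_1>P_2>0$, transmit signal-to-noise ratios $\rho_1,\rho_2>0$, path loss exponents $\alpha_1,\alpha_2>2$, bias factor $B>1$ and resource $W>0$. Let $Z_1,Z_2$ be independent with ${\rm Pr}(Z_j>r)=e^{-\pi\lambda_jr^2}$ (distances to the nearest points of two independent homogeneous Poisson processes of densities $\lambda_1,\lambda_2$) and put $\mathcal A_1={\rm Pr}(P_1Z_1^{-\alpha_1}\ge BP_2Z_2^{-\alpha_2})$, $\mathcal A_{2\bar O}={\rm Pr}(P_2Z_2^{-\alpha_2}>P_1Z_1^{-\alpha_1})$, $\mathcal A_{2O}={\rm Pr}(P_2Z_2^{-\alpha_2}\le P_1Z_1^{-\alpha_1}<BP_2Z_2^{-\alpha_2})$, $\mathcal A_2=\mathcal A_{2O}+\mathcal A_{2\bar O}$, $\kappa=\frac{\lambda_2\mathcal A_{2O}}{\lambda_1\mathcal A_2}$, $$f_{Y_1}(y)=\tfrac{2\pi\lambda_1}{\mathcal A_1}\,y\,e^{-\pi\left(\lambda_1y^2+\lambda_2(P_2B/P_1)^{2/\alpha_2}y^{2\alpha_1/\alpha_2}\right)},\qquad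 f_{Y_1,Y_2}(x,y)=\tfrac{4\pi^2\lambda_1\lambda_2}{\mathcal A_{2O}}\,xy\,e^{-\pi(\lambda_1x^2+\lambda_2y^2)}.$$ With $B'(a,b,z)=\int_z^1u^{a-1}(1-u)^{b-1}\,du$ let, for $j=1,2$, $m\ge0$, $$\mathcal L_j(s,r)=\exp\Big(-\tfrac{2\pi\lambda_j}{\alpha_j}s^{2/\alpha_j}B'\big(\tfrac2{\alpha_j},1-\tfrac2{\alpha_j},\tfrac1{1+sr^{-\alpha_j}}\big)\Big),$$ $$\tilde{\mathcal L}_j^{(m)}(s,r)=\mathcal L_j(s,r)\sum_{\substack{p_1,\dots,p_m\ge0\\ \sum_a a\,p_a=m}}\frac{m!}{\prod_{a}p_a!}\prod_{a=1}^m\Big(\tfrac{2\pi\lambda_j}{\alpha_j}s^{2/\alpha_j}B'\big(1+\tfrac2{\alpha_j},a-\tfrac2{\alpha_j},\tfrac1{1+sr^{-\alpha_j}}\big)\Big)^{p_a}.$$ Let $p_n=\frac{3.5^{3.5}\Gamma(n+3.5)}{\Gamma(3.5)\,n!}\kappa^n(3.5+\kappa)^{-(n+3.5)}$ for $n\ge0$,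 $\hat p_n=\frac{3.5^{3.5}\Gamma(n+3.5)}{\Gamma(n)\Gamma(3.5)}\kappa^{n-1}(3.5+\kappa)^{-(n+3.5)}$ for $n\ge1$, and for an integer $0\le U<N_1$ let $\pi_U(n)=p_n$ for $0\le n<U$, $\pi_U(U)=\sum_{u\ge U}p_u$, and $$q(U)=\tfrac{U}{\kappa}\Big(1-\big(1+\tfrac{\kappa}{3.5}\big)^{-3.5}\Big)-\sum_{n=1}^U\tfrac Un\hat p_n+\sum_{n=1}^U\hat p_n$$ (the probability that an offloaded user is selected for interference nulling). Let $r(y)=(P_2B/P_1)^{1/\alpha_2}y^{\alpha_1/\alpha_2}$, and let $D$ be the set of $(x,y)$ with $x>0$ and $(P_2/P_1)^{1/\alpha_2}x^{\alpha_1/\alpha_2}\le y\le(BP_2/P_1)^{1/\alpha_2}x^{\alpha_1/\alpha_2}$. For $\beta>0$ define the SIR coverage probabilities $$\mathcal S_1(U,\beta)=\sum_{u=0}^U\pi_U(u)\int_0^\infty\sum_{n=0}^{N_1-u-1}\frac1{n!}\sum_{k=0}^n\binom nk\tilde{\mathcal L}_1^{(k)}(\beta y^{\alpha_1},y)\,\tilde{\mathcal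 L}_2^{(n-k)}\big(\beta y^{\alpha_1}\tfrac{\rho_2}{\rho_1},r(y)\big)f_{Y_1}(y)\,dy,$$ $$\mathcal S_{2OC}(\beta)=\iint_D\sum_{n=0}^{N_2-1}\frac1{n!}\sum_{k=0}^n\binom nk\tilde{\mathcal L}_1^{(k)}\big(\beta y^{\alpha_2}\tfrac{\rho_1}{\rho_2},x\big)\,\tilde{\mathcal L}_2^{(n-k)}(\beta y^{\alpha_2},y)\,f_{Y_1,Y_2}(x,y)\,dy\,dx,$$ $$\mathcal S_{2O\bar C}(\beta)=\iint_D\sum_{n=0}^{N_2-1}\frac1{n!}\sum_{q_1+q_2+q_3=n}\binom n{q_1,q_2,q_3}\tilde{\mathcal L}_1^{(q_1)}\big(\beta y^{\alpha_2}\tfrac{\rho_1}{\rho_2},x\big)\,\tilde{\mathcal L}_2^{(q_2)}(\beta y^{\alpha_2},y)\,q_3!\,\frac{t^{q_3}}{(1+t)^{q_3+1}}\,f_{Y_1,Y_2}(x,y)\,dy\,dx,$$ where $t=\beta\frac{\rho_1y^{\alpha_2}}{\rho_2x^{\alpha_1}}$. Put $f(x)=2^x-1$, $\ell_j=1+1.28\frac{\lambda_u\mathcal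 A_j}{\lambda_j}$ (mean loads), and for a rate threshold $\tau>0$ $$\bar{\mathcal R}_1(U,\tau)=\mathcal S_1\big(U,f(\tfrac{\ell_1\tau}W)\big),\qquad \bar{\mathcal R}_{2O}(U,\tau)=q(U)\,\mathcal S_{2OC}\big(f(\tfrac{\ell_2\tau}W)\big)+(1-q(U))\,\mathcal S_{2O\bar C}\big(f(\tfrac{\ell_2\tau}W)\big),$$ the rate coverage probabilities (with mean load approximation) of a macro-user and of an offloaded user. For $1\le U\le N_1-1$ let $\Delta\bar{\mathcal R}_1(U,\tau)=\bar{\mathcal R}_1(U,\tau)-\bar{\mathcal R}_1(U-1,\tau)$ and $\Delta\bar{\mathcal R}_{2O}(U,\tau)=\bar{\mathcal R}_{2O}(U,\tau)-\bar{\mathcal R}_{2O}(U-1,\tau)$. Lemma. For every integer $U$ with $1\le U\le N_1-1$, as $\tau\to0^+$, $$\Delta\bar{\mathcal R}_{2O}(U,\tau)=\Theta(\tau^{N_2})\qquad\text{and}\qquad|\Delta\bar{\mathcal R}_1(U,\tau)|=\Theta(\tau^{N_1-U}),$$ where $g(\tau)=\Theta(h(\tau))$ means that $\lim_{\tau\to0^+}g(\tau)/h(\tau)$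 exists and lies in $(0,\infty)$. -/

import Mathlib

open MeasureTheory Set Filter Topology

/-- The system parameters of a downlink two-tier network (tier 1: macro, tier 2: pico) together with
the standing assumptions on them: antenna numbers `N₁`, `N₂`, transmit powers `P₁ > P₂`,
transmit signal-to-noise ratios `ρ₁`, `ρ₂`, base station densities `lam₁`, `lam₂`, user density `lamU`,
path loss exponents `α₁`, `α₂ > 2`, bias factor `B > 1`, and available resource `W`. -/
structure HetNet where
  (N₁ N₂ : ℕ)
  (P₁ P₂ ρ₁ ρ₂ lam₁ lam₂ lamU α₁ α₂ B W : ℝ)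
  N₁_pos : 0 < N₁
  N₂_pos : 0 < N₂
  P₂_pos : 0 < P₂
  P₂_lt_P₁ : P₂ < P₁
  ρ₁_pos : 0 < ρ₁
  ρ₂_pos : 0 < ρ₂
  lam₁_pos : 0 < lam₁
  lam₂_pos : 0 < lam₂
  lamU_pos : 0 < lamU
  two_lt_α₁ : 2 < α₁
  two_lt_α₂ : 2 < α₂
  one_lt_B : 1 < B
  W_pos : 0 < W

namespace HetNet

noncomputable section

/-- The law of the distance from the origin to the nearest point of a homogeneous Poisson point
process of density `lam` in the plane, with density `2 π lam r exp (-π lam r²)` on `r > 0`. -/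
def nearestLaw (lam : ℝ) : Measure ℝ :=
  (volume.restrict (Ioi 0)).withDensity
    fun r => ENNReal.ofReal (2 * Real.pi * lam * r * Real.exp (-(Real.pi * lam * r ^ 2)))

/-- The incomplete Beta function `∫_z^1 u^(a-1) (1-u)^(b-1) du`. -/
def betaInc (a b z : ℝ) : ℝ :=
  ∫ u in z..1, u ^ (a - 1) * (1 - u) ^ (b - 1)

/-- The Laplace transform at `s` of the interference (path loss exponent `α`, Rayleigh fading)
from the points of a Poisson process of density `lam` at distance more than `r`. -/
def laplace (lam α s r : ℝ) : ℝ :=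
  Real.exp (-(2 * Real.pi * lam / α * s ^ (2 / α)
    * betaInc (2 / α) (1 - 2 / α) (1 / (1 + s * r ^ (-α)))))

/-- The tuples `(p_1, …, p_m)` of natural numbers with `∑ a * p_a = m`
(`p_a` is stored at the index `a - 1`; each `p_a` is at most `m`). -/
def weightTuples (m : ℕ) : Finset (Fin m → ℕ) :=
  (Fintype.piFinset fun _ => Finset.range (m + 1)).filter fun p =>
    ∑ a : Fin m, ((a : ℕ) + 1) * p a = m

/-- The scaled `m`-th derivative `(-s)^m (d/ds)^m` of `laplace lam α s r`, in the explicit form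
of Faà di Bruno. -/
def laplaceDiff (lam α : ℝ) (m : ℕ) (s r : ℝ) : ℝ :=
  laplace lam α s r * ∑ p ∈ weightTuples m,
    (m.factorial : ℝ) / (∏ a : Fin m, ((p a).factorial : ℝ)) *
      ∏ a : Fin m, (2 * Real.pi / α * lam * s ^ (2 / α)
        * betaInc (1 + 2 / α) (((a : ℕ) + 1 : ℝ) - 2 / α) (1 / (1 + s * r ^ (-α)))) ^ (p a)

variable (H : HetNet)

/-- The joint law of the distances `(Z₁, Z₂)` of the typical user to its nearest macro base station
and its nearest pico base station; the two tiers are independent. -/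
def distLaw : Measure (ℝ × ℝ) :=
  (nearestLaw H.lam₁).prod (nearestLaw H.lam₂)

/-- The probability that the typical user is a macro-user. -/
def A₁ : ℝ :=
  H.distLaw.real {z | H.B * H.P₂ * z.2 ^ (-H.α₂) ≤ H.P₁ * z.1 ^ (-H.α₁)}

/-- The probability that the typical user is an unoffloaded pico-user. -/
def A₂nonO : ℝ :=
  H.distLaw.real {z | H.P₁ * z.1 ^ (-H.α₁) < H.P₂ * z.2 ^ (-H.α₂)}

/-- The probability that the typical user is an offloaded user. -/
def A₂O : ℝ :=
  H.distLaw.real {z | H.P₂ * z.2 ^ (-H.α₂) ≤ H.P₁ * z.1 ^ (-H.α₁) ∧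
    H.P₁ * z.1 ^ (-H.α₁) < H.B * H.P₂ * z.2 ^ (-H.α₂)}

/-- The probability that the typical user is a pico-user. -/
def A₂ : ℝ := H.A₂O + H.A₂nonO

/-- The density of the distance to the serving macro base station, given a macro-user. -/
def fY₁ (y : ℝ) : ℝ :=
  2 * Real.pi * H.lam₁ / H.A₁ * y * Real.exp (-(Real.pi * (H.lam₁ * y ^ 2
    + H.lam₂ * (H.P₂ * H.B / H.P₁) ^ (2 / H.α₂) * y ^ (2 * H.α₁ / H.α₂))))

/-- The joint density of the distances to the nearest macro and the nearest pico base station,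
given an offloaded user (to be used inside the offloading region only). -/
def fY₁Y₂ (x y : ℝ) : ℝ :=
  4 * Real.pi ^ 2 * H.lam₁ * H.lam₂ / H.A₂O * x * y
    * Real.exp (-(Real.pi * (H.lam₁ * x ^ 2 + H.lam₂ * y ^ 2)))

/-- The ratio `λ₂ A₂O / (A₂ λ₁)`. -/
def κ : ℝ := H.lam₂ * H.A₂O / (H.A₂ * H.lam₁)

/-- The (approximate) p.m.f. of the number of active offloaded users of the serving macro base
station of a macro-user. -/
def pmfActive (n : ℕ) : ℝ :=
  3.5 ^ (3.5 : ℝ) * Real.Gamma (n + 3.5) / (Real.Gamma 3.5 * n.factorial)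
    * H.κ ^ n * (3.5 + H.κ) ^ (-((n : ℝ) + 3.5))

/-- The (approximate) p.m.f., for `n ≥ 1`, of the number of active offloaded users of the nearest
macro base station of an offloaded user. -/
def pmfActiveHat (n : ℕ) : ℝ :=
  3.5 ^ (3.5 : ℝ) * Real.Gamma (n + 3.5) / (Real.Gamma n * Real.Gamma 3.5)
    * H.κ ^ (n - 1) * (3.5 + H.κ) ^ (-((n : ℝ) + 3.5))

/-- The p.m.f., for `n ≤ U`, of the number of degrees of freedom that the serving macro base
station of a macro-user spends on interference nulling. -/
def pmfIN (U n : ℕ) : ℝ :=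
  if n < U then H.pmfActive n else ∑' k : ℕ, H.pmfActive (n + k)

/-- The probability that an offloaded user is selected for interference nulling. -/
def probIN (U : ℕ) : ℝ :=
  U * H.lam₁ * H.A₂ / (H.lam₂ * H.A₂O)
      * (1 - (1 + H.lam₂ * H.A₂O / (3.5 * H.lam₁ * H.A₂)) ^ (-3.5 : ℝ))
    - ∑ n ∈ Finset.Icc 1 U, (U : ℝ) / n * H.pmfActiveHat n
    + ∑ n ∈ Finset.Icc 1 U, H.pmfActiveHat n

/-- SIR coverage probability of a macro-user at the SIR threshold `β`. -/
def S₁ (U : ℕ) (β : ℝ) : ℝ :=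
  ∑ u ∈ Finset.range (U + 1),
    (∫ y in Ioi (0 : ℝ),
      (∑ n ∈ Finset.range (H.N₁ - u), 1 / (n.factorial : ℝ) *
        ∑ k ∈ Finset.range (n + 1), (n.choose k : ℝ)
          * laplaceDiff H.lam₁ H.α₁ k (β * y ^ H.α₁) y
          * laplaceDiff H.lam₂ H.α₂ (n - k) (β * y ^ H.α₁ * (H.ρ₂ / H.ρ₁))
              ((H.P₂ * H.B / H.P₁) ^ (1 / H.α₂) * y ^ (H.α₁ / H.α₂)))
        * H.fY₁ y) * H.pmfIN U u

/-- SIR coverage probability of an offloaded user selected for interference nulling. -/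
def S₂OC (β : ℝ) : ℝ :=
  ∫ x in Ioi (0 : ℝ),
    ∫ y in ((H.P₂ / H.P₁) ^ (1 / H.α₂) * x ^ (H.α₁ / H.α₂))..
        ((H.B * H.P₂ / H.P₁) ^ (1 / H.α₂) * x ^ (H.α₁ / H.α₂)),
      (∑ n ∈ Finset.range H.N₂, 1 / (n.factorial : ℝ) *
        ∑ k ∈ Finset.range (n + 1), (n.choose k : ℝ)
          * laplaceDiff H.lam₁ H.α₁ k (β * y ^ H.α₂ * (H.ρ₁ / H.ρ₂)) x
          * laplaceDiff H.lam₂ H.α₂ (n - k) (β * y ^ H.α₂) y)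
        * H.fY₁Y₂ x y

/-- SIR coverage probability of an offloaded user not selected for interference nulling. -/
def S₂OnonC (β : ℝ) : ℝ :=
  ∫ x in Ioi (0 : ℝ),
    ∫ y in ((H.P₂ / H.P₁) ^ (1 / H.α₂) * x ^ (H.α₁ / H.α₂))..
        ((H.B * H.P₂ / H.P₁) ^ (1 / H.α₂) * x ^ (H.α₁ / H.α₂)),
      (∑ n ∈ Finset.range H.N₂, 1 / (n.factorial : ℝ) *
        ∑ q ∈ Finset.Nat.antidiagonalTuple 3 n, (Nat.multinomial Finset.univ q : ℝ)
          * laplaceDiff H.lam₁ H.α₁ (q 0) (β * y ^ H.α₂ * (H.ρ₁ / H.ρ₂)) x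
          * laplaceDiff H.lam₂ H.α₂ (q 1) (β * y ^ H.α₂) y
          * Real.Gamma (q 2 + 1)
          * (β * (H.ρ₁ * y ^ H.α₂ / (H.ρ₂ * x ^ H.α₁))) ^ (q 2)
          * ((1 + β * (H.ρ₁ * y ^ H.α₂ / (H.ρ₂ * x ^ H.α₁))) ^ (q 2 + 1))⁻¹)
        * H.fY₁Y₂ x y

/-- The SIR threshold that corresponds to the normalized rate `x`. -/
def sirThreshold (x : ℝ) : ℝ := (2 : ℝ) ^ x - 1

/-- The mean load of the serving macro base station. -/
def meanLoad₁ : ℝ := 1 + 1.28 * (H.lamU * H.A₁ / H.lam₁)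

/-- The mean load of the serving pico base station. -/
def meanLoad₂ : ℝ := 1 + 1.28 * (H.lamU * H.A₂ / H.lam₂)

/-- Rate coverage probability (mean load approximation) of a macro-user. -/
def R₁ (U : ℕ) (τ : ℝ) : ℝ := H.S₁ U (sirThreshold (H.meanLoad₁ * τ / H.W))

/-- Rate coverage probability (mean load approximation) of an offloaded user selected for
interference nulling. -/
def R₂OC (τ : ℝ) : ℝ := H.S₂OC (sirThreshold (H.meanLoad₂ * τ / H.W))

/-- Rate coverage probability (mean load approximation) of an offloaded user not selected for
interference nulling. -/
def R₂OnonC (τ : ℝ) : ℝ := H.S₂OnonC (sirThreshold (H.meanLoad₂ * τ / H.W))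

/-- Rate coverage probability (mean load approximation) of an offloaded user. -/
def R₂O (U : ℕ) (τ : ℝ) : ℝ :=
  H.probIN U * H.R₂OC τ + (1 - H.probIN U) * H.R₂OnonC τ

/-- Change of the rate coverage probability of a macro-user from `U - 1` to `U` (for `U ≥ 1`). -/
def ΔR₁ (U : ℕ) (τ : ℝ) : ℝ := H.R₁ U τ - H.R₁ (U - 1) τ

/-- Change of the rate coverage probability of an offloaded user from `U - 1` to `U`
(for `U ≥ 1`). -/
def ΔR₂O (U : ℕ) (τ : ℝ) : ℝ := H.R₂O U τ - H.R₂O (U - 1) τ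

end

end HetNet

/-- `f x = Θ (g x)` as `x → 0` from above, in the sharp sense that `f x / g x` has a limit in
`(0, ∞)`. -/
def ThetaAtZero (f g : ℝ → ℝ) : Prop :=
  ∃ c : ℝ, 0 < c ∧ Tendsto (fun x => f x / g x) (𝓝[>] 0) (𝓝 c)

/-!
Put `σ = s r⁻ᵅ`. In the explicit form of the scaled derivatives of the Laplace transform, the
incomplete Beta integral `B'(1 + 2/α, a - 2/α, 1/(1+σ))` runs over the short interval
`[1/(1+σ), 1]`, where `u ^ (2/α)` is close to `1`; so it is `(σ/(1+σ)) ^ (a - 2/α) / (a - 2/α)` up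
to a factor tending to `1`. Since the tuples in the sum have weight `∑ a p_a = m`, the `m`-th scaled
derivative lies between `L(s,r) (σ/(1+σ))ᵐ Q_m(r²)` and `σᵐ Q_m(r²)` for a polynomial `Q_m` with
positive coefficients (`momentPoly`, `le_laplaceDiff`, `laplaceDiff_le`). Hence its leading term as
`s → 0` is also a bound, which makes dominated convergence available
(`tendsto_integral_div_pow`): for a typical user `σ` is a bounded multiple of the SIR threshold `β`,
and the polynomials are integrable against the Gaussian-type densities of the distances.

For a macro-user, going from `U - 1` to `U` degrees of freedom moves the tail mass `∑_{u ≥ U} p_u`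
from the value with `N₁ - U + 1` antennas to the value with `N₁ - U`, so the change is minus the
tail times the single coverage term of index `N₁ - U` (`S₁_succ_sub`), which is of exact order
`β ^ (N₁ - U)`.

For an offloaded user the change is `(q(U) - q(U-1)) (S₂OC - S₂OnonC)`. As the active users seen by
an offloaded user are size-biased, `q(U) = κ⁻¹ ∑ₙ min(U, n) pₙ`, and the negative binomial series
gives `q(U) - q(U-1) = κ⁻¹ ∑_{n ≥ U} pₙ > 0` (`probIN_succ_sub`). Summing the geometric series
`∑_{q < K} t^q / (1+t)^(q+1) = 1 - (t/(1+t))^K` turns the difference of the coverage probabilities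
into a positive combination of the coverage terms of index `m < N₂` with the weights
`(t/(1+t)) ^ (N₂ - m)` (`S₂OnonC_eq`); as `t` is proportional to `β`, each is of exact order
`β ^ N₂`. Finally `β = 2 ^ (ℓ τ / W) - 1` is asymptotic to a positive multiple of `τ`.
-/

namespace HetNet

/-! ### Incomplete Beta integrals near the upper end point -/

lemma intervalIntegrable_one_sub_rpow {b z : ℝ} (hb : 0 < b) :
    IntervalIntegrable (fun u : ℝ => (1 - u) ^ (b - 1)) volume z 1 := by
  have h := (intervalIntegral.intervalIntegrable_rpow' (a := 1 - z) (b := 0)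
    (r := b - 1) (by linarith)).comp_sub_left 1
  simpa using h

lemma integral_one_sub_rpow {b z : ℝ} (hb : 0 < b) :
    ∫ u in z..1, (1 - u) ^ (b - 1) = (1 - z) ^ b / b := by
  rw [intervalIntegral.integral_comp_sub_left (fun u : ℝ => u ^ (b - 1)) 1,
    integral_rpow (Or.inl (by linarith))]
  simp [Real.zero_rpow hb.ne']

lemma intervalIntegrable_betaInc {a b z : ℝ} (hb : 0 < b) (hz : 0 < z) (hz1 : z ≤ 1) :
    IntervalIntegrable (fun u : ℝ => u ^ (a - 1) * (1 - u) ^ (b - 1)) volume z 1 := by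
  refine (intervalIntegrable_one_sub_rpow hb).continuousOn_mul ?_
  intro u hu
  rw [uIcc_of_le hz1] at hu
  exact (Real.continuousAt_rpow_const u _ (Or.inl (by linarith [hu.1]))).continuousWithinAt

lemma betaInc_nonneg {a b z : ℝ} (hz : 0 ≤ z) (hz1 : z ≤ 1) : 0 ≤ betaInc a b z := by
  refine intervalIntegral.integral_nonneg hz1 fun u hu => ?_
  exact mul_nonneg (Real.rpow_nonneg (by linarith [hu.1]) _)
    (Real.rpow_nonneg (by linarith [hu.2]) _)

lemma betaInc_le_of_le {a b z C : ℝ} (hb : 0 < b) (hz : 0 < z) (hz1 : z ≤ 1)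
    (hC : ∀ u ∈ Icc z 1, u ^ (a - 1) ≤ C) : betaInc a b z ≤ C * ((1 - z) ^ b / b) := by
  rw [← integral_one_sub_rpow hb, ← intervalIntegral.integral_const_mul]
  refine intervalIntegral.integral_mono_on hz1 (intervalIntegrable_betaInc hb hz hz1)
    ((intervalIntegrable_one_sub_rpow hb).const_mul C) fun u hu => ?_
  exact mul_le_mul_of_nonneg_right (hC u hu) (Real.rpow_nonneg (by linarith [hu.2]) _)

lemma le_betaInc_of_le {a b z C : ℝ} (hb : 0 < b) (hz : 0 < z) (hz1 : z ≤ 1)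
    (hC : ∀ u ∈ Icc z 1, C ≤ u ^ (a - 1)) : C * ((1 - z) ^ b / b) ≤ betaInc a b z := by
  rw [← integral_one_sub_rpow hb, ← intervalIntegral.integral_const_mul]
  refine intervalIntegral.integral_mono_on hz1
    ((intervalIntegrable_one_sub_rpow hb).const_mul C) (intervalIntegrable_betaInc hb hz hz1)
    fun u hu => ?_
  exact mul_le_mul_of_nonneg_right (hC u hu) (Real.rpow_nonneg (by linarith [hu.2]) _)

lemma measurable_betaInc (a b : ℝ) : Measurable (betaInc a b) := by
  have hf : Measurable fun q : ℝ × ℝ => q.2 ^ (a - 1) * (1 - q.2) ^ (b - 1) := by fun_prop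
  have key : ∀ S : Set (ℝ × ℝ), MeasurableSet S → Measurable fun z : ℝ =>
      ∫ u, S.indicator (fun q : ℝ × ℝ => q.2 ^ (a - 1) * (1 - q.2) ^ (b - 1)) (z, u) := by
    intro S hS
    exact ((hf.indicator hS).stronglyMeasurable.integral_prod_right'
      (ν := (volume : Measure ℝ))).measurable
  have h1 := key {q | q.1 < q.2 ∧ q.2 ≤ 1}
    ((measurableSet_lt measurable_fst measurable_snd).inter
      (measurableSet_le measurable_snd measurable_const))
  have h2 := key {q | 1 < q.2 ∧ q.2 ≤ q.1}
    ((measurableSet_lt measurable_const measurable_snd).inter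
      (measurableSet_le measurable_snd measurable_fst))
  convert h1.sub h2 using 1
  ext z
  simp only [betaInc, intervalIntegral, Pi.sub_apply]
  rw [← integral_indicator measurableSet_Ioc, ← integral_indicator measurableSet_Ioc]
  rfl

/-! ### Small-argument behaviour of the scaled derivatives of the Laplace transform -/

/-- The coefficient `2πλ / (α (a - 2/α))` of the leading term
`v (s r⁻ᵅ)ᵃ`, `v = r²`, of the `a`-th scaled derivative of the Laplace exponent as `s → 0`. -/
noncomputable def exponentCoeff (lam α : ℝ) (a : ℕ) : ℝ :=
  2 * Real.pi / α * lam / ((a : ℝ) - 2 / α)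

/-- The polynomial `Q_m` in `v = r²` for which
`laplaceDiff lam α m s r ∼ (s r⁻ᵅ)ᵐ Q_m(r²)` as `s → 0`. -/
noncomputable def momentPoly (lam α : ℝ) (m : ℕ) (v : ℝ) : ℝ :=
  ∑ p ∈ weightTuples m, (m.factorial : ℝ) / (∏ a : Fin m, ((p a).factorial : ℝ)) *
    ∏ a : Fin m, (exponentCoeff lam α ((a : ℕ) + 1) * v) ^ (p a)

lemma sum_of_mem_weightTuples {m : ℕ} {p : Fin m → ℕ} (hp : p ∈ weightTuples m) :
    ∑ a : Fin m, ((a : ℕ) + 1) * p a = m := (Finset.mem_filter.1 hp).2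

lemma prod_pow_of_mem_weightTuples {m : ℕ} {p : Fin m → ℕ} (hp : p ∈ weightTuples m)
    (x : ℝ) : ∏ a : Fin m, (x ^ ((a : ℕ) + 1)) ^ (p a) = x ^ m := by
  simp_rw [← pow_mul, Finset.prod_pow_eq_pow_sum, sum_of_mem_weightTuples hp]

/-- `weightTuples m` contains the tuple with `p_1 = m` and `p_a = 0` otherwise. -/
lemma weightTuples_nonempty (m : ℕ) : (weightTuples m).Nonempty := by
  refine ⟨fun a => if (a : ℕ) = 0 then m else 0, ?_⟩
  simp only [weightTuples, Finset.mem_filter, Fintype.mem_piFinset, Finset.mem_range]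
  refine ⟨fun a => by split_ifs <;> omega, ?_⟩
  cases m with
  | zero => simp
  | succ m => simp

section OneTier

variable {lam α s r : ℝ}

lemma exponentCoeff_pos (hlam : 0 < lam) (hα : 2 < α) {a : ℕ} (ha : 1 ≤ a) :
    0 < exponentCoeff lam α a := by
  have h1 : 2 / α < 1 := (div_lt_one (by linarith)).2 hα
  have h2 : (1 : ℝ) ≤ a := by exact_mod_cast ha
  have := Real.pi_pos
  have : 0 < (a : ℝ) - 2 / α := by linarith
  unfold exponentCoeff
  positivity

lemma momentPoly_pos (hlam : 0 < lam) (hα : 2 < α) (m : ℕ) {v : ℝ} (hv : 0 < v) :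
    0 < momentPoly lam α m v := by
  refine Finset.sum_pos (fun p _ => ?_) (weightTuples_nonempty m)
  refine mul_pos (by positivity) (Finset.prod_pos fun a _ => pow_pos ?_ _)
  exact mul_pos (exponentCoeff_pos hlam hα (by omega)) hv

lemma momentPoly_nonneg (hlam : 0 < lam) (hα : 2 < α) (m : ℕ) {v : ℝ} (hv : 0 ≤ v) :
    0 ≤ momentPoly lam α m v := by
  refine Finset.sum_nonneg fun p _ => ?_
  refine mul_nonneg (by positivity) (Finset.prod_nonneg fun a _ => pow_nonneg ?_ _)
  exact mul_nonneg (exponentCoeff_pos hlam hα (by omega)).le hv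

/-- A polynomial with nonnegative argument grows slower than any exponential. -/
lemma exists_momentPoly_le_exp (hlam : 0 < lam) (hα : 2 < α) (m : ℕ) {δ : ℝ} (hδ : 0 < δ) :
    ∃ K : ℝ, 0 ≤ K ∧ ∀ v, 0 ≤ v → momentPoly lam α m v ≤ K * Real.exp (δ * v) := by
  refine ⟨∑ p ∈ weightTuples m, (m.factorial : ℝ) / (∏ a : Fin m, ((p a).factorial : ℝ)) *
    ((∏ a : Fin m, (exponentCoeff lam α ((a : ℕ) + 1)) ^ (p a)) *
      (((∑ a, p a).factorial : ℝ) / δ ^ (∑ a, p a))), ?_, fun v hv => ?_⟩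
  · refine Finset.sum_nonneg fun p _ => ?_
    refine mul_nonneg (by positivity) (mul_nonneg (Finset.prod_nonneg fun a _ =>
      pow_nonneg (exponentCoeff_pos hlam hα (by omega)).le _) (by positivity))
  · rw [Finset.sum_mul]
    refine Finset.sum_le_sum fun p _ => ?_
    rw [mul_assoc]
    refine mul_le_mul_of_nonneg_left ?_ (by positivity)
    simp_rw [mul_pow, Finset.prod_mul_distrib, Finset.prod_pow_eq_pow_sum]
    rw [mul_assoc]
    refine mul_le_mul_of_nonneg_left ?_ (Finset.prod_nonneg fun a _ =>
      pow_nonneg (exponentCoeff_pos hlam hα (by omega)).le _)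
    have h := Real.pow_div_factorial_le_exp (δ * v) (by positivity) (∑ a, p a)
    rw [div_le_iff₀ (by positivity), mul_pow] at h
    rw [div_mul_eq_mul_div, le_div_iff₀ (by positivity)]
    linarith

/-- The lower limit `1 / (1 + s r⁻ᵅ)` of the incomplete Beta integrals. -/
lemma betaInc_limit_mem (hs : 0 < s) (hr : 0 < r) :
    0 < 1 / (1 + s * r ^ (-α)) ∧ 1 / (1 + s * r ^ (-α)) ≤ 1 := by
  have : 0 < s * r ^ (-α) := mul_pos hs (Real.rpow_pos_of_pos hr _)
  exact ⟨by positivity, by rw [div_le_one (by positivity)]; linarith⟩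

/-- In terms of `σ = s r⁻ᵅ`, the power of the length of the Beta integration range combines with
`s ^ (2/α)` into `r² σ^(b+2/α) / (1+σ)^b`. -/
lemma rpow_mul_one_sub_limit_rpow (hα : 2 < α) (hs : 0 < s) (hr : 0 < r) (b : ℝ) :
    s ^ (2 / α) * (1 - 1 / (1 + s * r ^ (-α))) ^ b
      = r ^ 2 * (s * r ^ (-α)) ^ (b + 2 / α) * (1 + s * r ^ (-α)) ^ (-b) := by
  have hσ : 0 < s * r ^ (-α) := mul_pos hs (Real.rpow_pos_of_pos hr _)
  have h1 : 1 - 1 / (1 + s * r ^ (-α)) = (s * r ^ (-α)) / (1 + s * r ^ (-α)) := by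
    field_simp; ring
  have h2 : s ^ (2 / α) = r ^ 2 * (s * r ^ (-α)) ^ (2 / α) := by
    rw [Real.mul_rpow hs.le (Real.rpow_nonneg hr.le _), ← Real.rpow_mul hr.le]
    have : -α * (2 / α) = -2 := by field_simp
    rw [this, Real.rpow_neg hr.le, Real.rpow_two]
    field_simp
  rw [h1, h2, Real.div_rpow hσ.le (by positivity), Real.rpow_add hσ,
    Real.rpow_neg (show 0 ≤ 1 + s * r ^ (-α) by positivity) b, div_eq_mul_inv]
  ring

/-- The left-hand side is the `a`-th scaled derivative, divided by `a!`, of the Laplace exponent;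
it is bounded by its leading term, as `u ^ (2/α) ≤ 1` in the Beta integral. -/
lemma laplaceExponent_deriv_le (hlam : 0 < lam) (hα : 2 < α) (hs : 0 < s) (hr : 0 < r)
    {a : ℕ} (ha : 1 ≤ a) :
    2 * Real.pi / α * lam * s ^ (2 / α)
        * betaInc (1 + 2 / α) ((a : ℝ) - 2 / α) (1 / (1 + s * r ^ (-α)))
      ≤ exponentCoeff lam α a * r ^ 2 * (s * r ^ (-α)) ^ a := by
  obtain ⟨hz, hz1⟩ := betaInc_limit_mem (α := α) hs hr
  have hσ : 0 < s * r ^ (-α) := mul_pos hs (Real.rpow_pos_of_pos hr _)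
  have h1 : 2 / α < 1 := (div_lt_one (by linarith)).2 hα
  have h2 : (1 : ℝ) ≤ a := by exact_mod_cast ha
  have h0 : 0 < 2 / α := by positivity
  have hb : 0 < (a : ℝ) - 2 / α := by linarith
  have hpi := Real.pi_pos
  have key := betaInc_le_of_le (a := 1 + 2 / α) (C := 1) hb hz hz1 fun u hu =>
    Real.rpow_le_one (by linarith [hu.1]) hu.2 (by linarith)
  have e := rpow_mul_one_sub_limit_rpow hα hs hr ((a : ℝ) - 2 / α)
  rw [sub_add_cancel, Real.rpow_natCast] at e
  calc _ ≤ 2 * Real.pi / α * lam * s ^ (2 / α)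
        * (1 * ((1 - 1 / (1 + s * r ^ (-α))) ^ ((a : ℝ) - 2 / α) / ((a : ℝ) - 2 / α))) := by
        gcongr
    _ = exponentCoeff lam α a * (s ^ (2 / α)
          * (1 - 1 / (1 + s * r ^ (-α))) ^ ((a : ℝ) - 2 / α)) := by
        rw [exponentCoeff]; ring
    _ = exponentCoeff lam α a * r ^ 2 * (s * r ^ (-α)) ^ a
          * (1 + s * r ^ (-α)) ^ (-((a : ℝ) - 2 / α)) := by rw [e]; ring
    _ ≤ exponentCoeff lam α a * r ^ 2 * (s * r ^ (-α)) ^ a * 1 := by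
        have := exponentCoeff_pos hlam hα ha
        gcongr
        exact Real.rpow_le_one_of_one_le_of_nonpos (by linarith) (by linarith)
    _ = _ := by ring

/-- Lower counterpart of `laplaceExponent_deriv_le`, as `u ^ (2/α)` is at least its value at the
lower limit of integration. -/
lemma le_laplaceExponent_deriv (hlam : 0 < lam) (hα : 2 < α) (hs : 0 < s) (hr : 0 < r)
    {a : ℕ} (ha : 1 ≤ a) :
    exponentCoeff lam α a * r ^ 2 * (s * r ^ (-α) / (1 + s * r ^ (-α))) ^ a ≤
      2 * Real.pi / α * lam * s ^ (2 / α)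
        * betaInc (1 + 2 / α) ((a : ℝ) - 2 / α) (1 / (1 + s * r ^ (-α))) := by
  obtain ⟨hz, hz1⟩ := betaInc_limit_mem (α := α) hs hr
  have hσ : 0 < s * r ^ (-α) := mul_pos hs (Real.rpow_pos_of_pos hr _)
  have h1 : 2 / α < 1 := (div_lt_one (by linarith)).2 hα
  have h2 : (1 : ℝ) ≤ a := by exact_mod_cast ha
  have h0 : 0 < 2 / α := by positivity
  have hb : 0 < (a : ℝ) - 2 / α := by linarith
  have hpi := Real.pi_pos
  have key := le_betaInc_of_le (a := 1 + 2 / α)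
    (C := (1 / (1 + s * r ^ (-α))) ^ (2 / α)) hb hz hz1 fun u hu => by
      rw [add_sub_cancel_left]
      exact Real.rpow_le_rpow hz.le hu.1 h0.le
  have e := rpow_mul_one_sub_limit_rpow hα hs hr ((a : ℝ) - 2 / α)
  rw [sub_add_cancel, Real.rpow_natCast] at e
  have e2 : (1 / (1 + s * r ^ (-α))) ^ (2 / α) * (1 + s * r ^ (-α)) ^ (-((a : ℝ) - 2 / α))
      = ((1 + s * r ^ (-α)) ^ a)⁻¹ := by
    rw [one_div, Real.inv_rpow (by positivity), ← Real.rpow_neg (by positivity),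
      ← Real.rpow_add (by positivity), ← Real.rpow_natCast, ← Real.rpow_neg (by positivity)]
    congr 1; ring
  calc _ = exponentCoeff lam α a * ((1 / (1 + s * r ^ (-α))) ^ (2 / α)
        * (r ^ 2 * (s * r ^ (-α)) ^ a * (1 + s * r ^ (-α)) ^ (-((a : ℝ) - 2 / α)))) := by
        rw [div_pow, div_eq_mul_inv _ ((1 + s * r ^ (-α)) ^ a), ← e2]; ring
    _ = 2 * Real.pi / α * lam * s ^ (2 / α) * ((1 / (1 + s * r ^ (-α))) ^ (2 / α)
        * ((1 - 1 / (1 + s * r ^ (-α))) ^ ((a : ℝ) - 2 / α) / ((a : ℝ) - 2 / α))) := by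
        rw [← e, exponentCoeff]; ring
    _ ≤ _ := by gcongr

lemma laplace_pos : 0 < laplace lam α s r := Real.exp_pos _

lemma laplace_le_one (hlam : 0 < lam) (hα : 2 < α) (hs : 0 < s) (hr : 0 < r) :
    laplace lam α s r ≤ 1 := by
  obtain ⟨hz, hz1⟩ := betaInc_limit_mem (α := α) hs hr
  have := betaInc_nonneg (a := 2 / α) (b := 1 - 2 / α) hz.le hz1
  have hpi := Real.pi_pos
  have : 0 < α := by linarith
  rw [laplace, Real.exp_le_one_iff, neg_nonpos]
  positivity

lemma exp_le_laplace (hlam : 0 < lam) (hα : 2 < α) (hs : 0 < s) (hr : 0 < r) :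
    Real.exp (-(exponentCoeff lam α 1 * r ^ 2 * ((s * r ^ (-α)) * (1 + s * r ^ (-α)))))
      ≤ laplace lam α s r := by
  obtain ⟨hz, hz1⟩ := betaInc_limit_mem (α := α) hs hr
  have hσ : 0 < s * r ^ (-α) := mul_pos hs (Real.rpow_pos_of_pos hr _)
  have h1 : 2 / α < 1 := (div_lt_one (by linarith)).2 hα
  have h0 : 0 < 2 / α := by positivity
  have hb : 0 < 1 - 2 / α := by linarith
  have hpi := Real.pi_pos
  have hC := exponentCoeff_pos hlam hα le_rfl
  -- On the integration range `u ^ (2/α - 1) ≤ u⁻¹ ≤ 1 + s r⁻ᵅ`.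
  have key := betaInc_le_of_le (a := 2 / α) (C := 1 + s * r ^ (-α)) hb hz hz1 fun u hu => by
    have hu0 : 0 < u := lt_of_lt_of_le hz hu.1
    rw [Real.rpow_sub_one hu0.ne', div_le_iff₀ hu0]
    have h3 : u ^ (2 / α) ≤ 1 := Real.rpow_le_one hu0.le hu.2 h0.le
    have h4 := hu.1
    rw [div_le_iff₀ (by positivity)] at h4
    linarith
  have e := rpow_mul_one_sub_limit_rpow hα hs hr (1 - 2 / α)
  rw [sub_add_cancel, Real.rpow_one] at e
  rw [laplace, Real.exp_le_exp, neg_le_neg_iff]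
  calc _ ≤ 2 * Real.pi * lam / α * s ^ (2 / α) * ((1 + s * r ^ (-α))
        * ((1 - 1 / (1 + s * r ^ (-α))) ^ (1 - 2 / α) / (1 - 2 / α))) := by gcongr
    _ = exponentCoeff lam α 1 * (1 + s * r ^ (-α)) * (s ^ (2 / α)
          * (1 - 1 / (1 + s * r ^ (-α))) ^ (1 - 2 / α)) := by
        rw [exponentCoeff]; push_cast; ring
    _ = exponentCoeff lam α 1 * r ^ 2 * ((s * r ^ (-α)) * (1 + s * r ^ (-α)))
          * (1 + s * r ^ (-α)) ^ (-(1 - 2 / α)) := by rw [e]; ring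
    _ ≤ exponentCoeff lam α 1 * r ^ 2 * ((s * r ^ (-α)) * (1 + s * r ^ (-α))) * 1 := by
        gcongr
        exact Real.rpow_le_one_of_one_le_of_nonpos (by linarith) (by linarith)
    _ = _ := by ring

lemma laplaceDiff_nonneg (hlam : 0 < lam) (hα : 2 < α) (hs : 0 < s) (hr : 0 < r) (m : ℕ) :
    0 ≤ laplaceDiff lam α m s r := by
  obtain ⟨hz, hz1⟩ := betaInc_limit_mem (α := α) hs hr
  have hpi := Real.pi_pos
  have : 0 < α := by linarith
  refine mul_nonneg laplace_pos.le (Finset.sum_nonneg fun p _ => mul_nonneg (by positivity)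
    (Finset.prod_nonneg fun a _ => pow_nonneg ?_ _))
  have := betaInc_nonneg (a := 1 + 2 / α) (b := ((a : ℕ) + 1 : ℝ) - 2 / α) hz.le hz1
  positivity

lemma laplaceDiff_le (hlam : 0 < lam) (hα : 2 < α) (hs : 0 < s) (hr : 0 < r) (m : ℕ) :
    laplaceDiff lam α m s r ≤ (s * r ^ (-α)) ^ m * momentPoly lam α m (r ^ 2) := by
  obtain ⟨hz, hz1⟩ := betaInc_limit_mem (α := α) hs hr
  have hpi := Real.pi_pos
  have : 0 < α := by linarith
  have hnn : ∀ a : ℕ, 0 ≤ 2 * Real.pi / α * lam * s ^ (2 / α)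
      * betaInc (1 + 2 / α) ((a + 1 : ℝ) - 2 / α) (1 / (1 + s * r ^ (-α))) := fun a => by
    have := betaInc_nonneg (a := 1 + 2 / α) (b := (a + 1 : ℝ) - 2 / α) hz.le hz1
    positivity
  rw [laplaceDiff]
  refine (mul_le_of_le_one_left ?_ (laplace_le_one hlam hα hs hr)).trans ?_
  · exact Finset.sum_nonneg fun p _ => mul_nonneg (by positivity)
      (Finset.prod_nonneg fun a _ => pow_nonneg (hnn a) _)
  rw [momentPoly, Finset.mul_sum]
  refine Finset.sum_le_sum fun p hp => ?_
  rw [← prod_pow_of_mem_weightTuples hp, mul_left_comm, ← Finset.prod_mul_distrib]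
  refine mul_le_mul_of_nonneg_left ?_ (by positivity)
  refine Finset.prod_le_prod (fun a _ => pow_nonneg (hnn a) _) fun a _ => ?_
  rw [← mul_pow]
  refine pow_le_pow_left₀ (hnn a) ?_ _
  have := laplaceExponent_deriv_le hlam hα hs hr (a := (a : ℕ) + 1) (by omega)
  push_cast at this
  linarith

lemma le_laplaceDiff (hlam : 0 < lam) (hα : 2 < α) (hs : 0 < s) (hr : 0 < r) (m : ℕ) :
    laplace lam α s r * ((s * r ^ (-α) / (1 + s * r ^ (-α))) ^ m * momentPoly lam α m (r ^ 2))
      ≤ laplaceDiff lam α m s r := by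
  have hσ : 0 < s * r ^ (-α) := mul_pos hs (Real.rpow_pos_of_pos hr _)
  refine mul_le_mul_of_nonneg_left ?_ laplace_pos.le
  rw [momentPoly, Finset.mul_sum]
  refine Finset.sum_le_sum fun p hp => ?_
  rw [← prod_pow_of_mem_weightTuples hp, mul_left_comm, ← Finset.prod_mul_distrib]
  refine mul_le_mul_of_nonneg_left ?_ (by positivity)
  have hC : ∀ a : ℕ, 0 < exponentCoeff lam α (a + 1) := fun a =>
    exponentCoeff_pos hlam hα (by omega)
  refine Finset.prod_le_prod (fun a _ => ?_) fun a _ => ?_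
  · have := hC a
    positivity
  rw [← mul_pow]
  refine pow_le_pow_left₀ (by have := hC a; positivity) ?_ _
  have := le_laplaceExponent_deriv hlam hα hs hr (a := (a : ℕ) + 1) (by omega)
  push_cast at this
  linarith

/-- As `β → 0⁺`, `laplaceDiff lam α m (β w) r` is asymptotic to `βᵐ (w r⁻ᵅ)ᵐ Q_m(r²)`. -/
lemma tendsto_laplaceDiff_div (hlam : 0 < lam) (hα : 2 < α) {w : ℝ} (hw : 0 < w) (hr : 0 < r)
    (m : ℕ) :
    Tendsto (fun β : ℝ => laplaceDiff lam α m (β * w) r / β ^ m) (𝓝[>] 0)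
      (𝓝 ((w * r ^ (-α)) ^ m * momentPoly lam α m (r ^ 2))) := by
  set c := w * r ^ (-α) with hc
  have hc0 : 0 < c := mul_pos hw (Real.rpow_pos_of_pos hr _)
  have hM := momentPoly_pos hlam hα m (pow_pos hr 2)
  have hlow : Tendsto (fun β : ℝ =>
      Real.exp (-(exponentCoeff lam α 1 * r ^ 2 * ((β * c) * (1 + β * c))))
        * ((c / (1 + β * c)) ^ m * momentPoly lam α m (r ^ 2))) (𝓝[>] 0)
      (𝓝 (c ^ m * momentPoly lam α m (r ^ 2))) := by
    have : ContinuousAt (fun β : ℝ =>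
      Real.exp (-(exponentCoeff lam α 1 * r ^ 2 * ((β * c) * (1 + β * c))))
        * ((c / (1 + β * c)) ^ m * momentPoly lam α m (r ^ 2))) 0 := by
      have : (1 + (0 : ℝ) * c) ≠ 0 := by simp
      fun_prop (disch := assumption)
    have h := this.tendsto.mono_left (nhdsWithin_le_nhds (s := Ioi 0))
    simpa using h
  refine tendsto_of_tendsto_of_tendsto_of_le_of_le' hlow tendsto_const_nhds ?_ ?_
  · filter_upwards [self_mem_nhdsWithin] with β hβ
    have hβ : 0 < β := hβ
    have e : β * w * r ^ (-α) = β * c := by rw [hc]; ring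
    have h1 := exp_le_laplace hlam hα (mul_pos hβ hw) hr
    have h2 := le_laplaceDiff hlam hα (mul_pos hβ hw) hr m
    rw [e] at h1 h2
    rw [le_div_iff₀ (pow_pos hβ m)]
    refine le_trans ?_ h2
    have e2 : (β * c / (1 + β * c)) ^ m = (c / (1 + β * c)) ^ m * β ^ m := by
      rw [← mul_pow]; congr 1; ring
    rw [e2, mul_assoc]
    refine mul_le_mul h1 (le_of_eq (by ring)) (by positivity) laplace_pos.le
  · filter_upwards [self_mem_nhdsWithin] with β hβ
    have hβ : 0 < β := hβ
    have h2 := laplaceDiff_le hlam hα (mul_pos hβ hw) hr m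
    rw [div_le_iff₀ (pow_pos hβ m)]
    refine h2.trans (le_of_eq ?_)
    rw [mul_assoc β, mul_pow β]; ring

end OneTier

lemma measurable_laplaceDiff (lam α : ℝ) (m : ℕ) :
    Measurable fun q : ℝ × ℝ => laplaceDiff lam α m q.1 q.2 := by
  have hz : Measurable fun q : ℝ × ℝ => 1 / (1 + q.1 * q.2 ^ (-α)) := by fun_prop
  have hb : ∀ a b : ℝ, Measurable fun q : ℝ × ℝ => betaInc a b (1 / (1 + q.1 * q.2 ^ (-α))) :=
    fun a b => (measurable_betaInc a b).comp hz
  unfold laplaceDiff laplace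
  fun_prop

/-! ### Combining the two tiers -/

section TwoTier

variable (H : HetNet)

/-- The `n`-th coverage term `(1/n!) ∑ₖ (n choose k) L̃₁⁽ᵏ⁾(s₁, r₁) L̃₂⁽ⁿ⁻ᵏ⁾(s₂, r₂)`: the probability
that a Poisson variable whose mean is the normalized total interference equals `n`. -/
noncomputable def tierTerm (n : ℕ) (s₁ r₁ s₂ r₂ : ℝ) : ℝ :=
  1 / (n.factorial : ℝ) * ∑ k ∈ Finset.range (n + 1), (n.choose k : ℝ)
    * laplaceDiff H.lam₁ H.α₁ k s₁ r₁ * laplaceDiff H.lam₂ H.α₂ (n - k) s₂ r₂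

/-- The upper bound, and leading term, of `tierTerm n s₁ r₁ s₂ r₂`, in terms of
`θⱼ = sⱼ rⱼ ^ (-αⱼ)` and `vⱼ = rⱼ²`; it is homogeneous of degree `n` in `(θ₁, θ₂)`. -/
noncomputable def tierPoly (n : ℕ) (θ₁ v₁ θ₂ v₂ : ℝ) : ℝ :=
  1 / (n.factorial : ℝ) * ∑ k ∈ Finset.range (n + 1), (n.choose k : ℝ)
    * (θ₁ ^ k * momentPoly H.lam₁ H.α₁ k v₁) * (θ₂ ^ (n - k) * momentPoly H.lam₂ H.α₂ (n - k) v₂)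

variable {s₁ r₁ s₂ r₂ θ₁ v₁ θ₂ v₂ : ℝ}

lemma tierTerm_nonneg (n : ℕ) (hs₁ : 0 < s₁) (hr₁ : 0 < r₁) (hs₂ : 0 < s₂) (hr₂ : 0 < r₂) :
    0 ≤ H.tierTerm n s₁ r₁ s₂ r₂ := by
  refine mul_nonneg (by positivity) (Finset.sum_nonneg fun k _ => ?_)
  exact mul_nonneg (mul_nonneg (by positivity)
    (laplaceDiff_nonneg H.lam₁_pos H.two_lt_α₁ hs₁ hr₁ k))
    (laplaceDiff_nonneg H.lam₂_pos H.two_lt_α₂ hs₂ hr₂ (n - k))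

lemma tierTerm_le (n : ℕ) (hs₁ : 0 < s₁) (hr₁ : 0 < r₁) (hs₂ : 0 < s₂) (hr₂ : 0 < r₂) :
    H.tierTerm n s₁ r₁ s₂ r₂
      ≤ H.tierPoly n (s₁ * r₁ ^ (-H.α₁)) (r₁ ^ 2) (s₂ * r₂ ^ (-H.α₂)) (r₂ ^ 2) := by
  refine mul_le_mul_of_nonneg_left (Finset.sum_le_sum fun k _ => ?_) (by positivity)
  have h1 := laplaceDiff_nonneg H.lam₁_pos H.two_lt_α₁ hs₁ hr₁ k
  have h2 := laplaceDiff_nonneg H.lam₂_pos H.two_lt_α₂ hs₂ hr₂ (n - k)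
  have h3 := laplaceDiff_le H.lam₁_pos H.two_lt_α₁ hs₁ hr₁ k
  have h4 := laplaceDiff_le H.lam₂_pos H.two_lt_α₂ hs₂ hr₂ (n - k)
  exact mul_le_mul (mul_le_mul_of_nonneg_left h3 (by positivity)) h4 h2
    (mul_nonneg (by positivity) (h1.trans h3))

lemma tierPoly_pos (n : ℕ) (hθ₁ : 0 < θ₁) (hv₁ : 0 < v₁) (hθ₂ : 0 < θ₂) (hv₂ : 0 < v₂) :
    0 < H.tierPoly n θ₁ v₁ θ₂ v₂ := by
  unfold tierPoly
  refine mul_pos (by positivity) (Finset.sum_pos (fun k hk => ?_) (by simp))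
  have h1 := momentPoly_pos H.lam₁_pos H.two_lt_α₁ k hv₁
  have h2 := momentPoly_pos H.lam₂_pos H.two_lt_α₂ (n - k) hv₂
  have h3 : 0 < n.choose k := Nat.choose_pos (by simpa [Nat.lt_succ_iff] using hk)
  positivity

lemma tierPoly_smul (n : ℕ) (β : ℝ) :
    H.tierPoly n (β * θ₁) v₁ (β * θ₂) v₂ = β ^ n * H.tierPoly n θ₁ v₁ θ₂ v₂ := by
  unfold tierPoly
  rw [mul_left_comm (β ^ n), Finset.mul_sum _ _ (β ^ n)]
  refine congrArg _ (Finset.sum_congr rfl fun k hk => ?_)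
  have : β ^ n = β ^ k * β ^ (n - k) := by
    rw [← pow_add, Nat.add_sub_cancel' (by simpa [Nat.lt_succ_iff] using hk)]
  rw [this, mul_pow, mul_pow]
  ring

/-- Arbitrarily small exponential rates `δ₁, δ₂` bound `tierPoly` uniformly in `θ₁, θ₂ ≤ T`. -/
lemma exists_tierPoly_le (n : ℕ) {δ₁ δ₂ T : ℝ} (hδ₁ : 0 < δ₁) (hδ₂ : 0 < δ₂) :
    ∃ K : ℝ, 0 ≤ K ∧ ∀ θ₁ v₁ θ₂ v₂ : ℝ, 0 ≤ θ₁ → θ₁ ≤ T → 0 ≤ θ₂ → θ₂ ≤ T → 0 ≤ v₁ → 0 ≤ v₂ →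
      H.tierPoly n θ₁ v₁ θ₂ v₂ ≤ K * (Real.exp (δ₁ * v₁) * Real.exp (δ₂ * v₂)) := by
  choose K₁ hK₁ h₁ using fun k => exists_momentPoly_le_exp H.lam₁_pos H.two_lt_α₁ k hδ₁
  choose K₂ hK₂ h₂ using fun k => exists_momentPoly_le_exp H.lam₂_pos H.two_lt_α₂ k hδ₂
  refine ⟨1 / (n.factorial : ℝ) * ∑ k ∈ Finset.range (n + 1), (n.choose k : ℝ)
    * (|T| ^ k * K₁ k) * (|T| ^ (n - k) * K₂ (n - k)), ?_, ?_⟩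
  · refine mul_nonneg (by positivity) (Finset.sum_nonneg fun k _ => ?_)
    have := hK₁ k
    have := hK₂ (n - k)
    positivity
  · intro θ₁ v₁ θ₂ v₂ hθ₁ hT₁ hθ₂ hT₂ hv₁ hv₂
    rw [mul_assoc, Finset.sum_mul]
    refine mul_le_mul_of_nonneg_left (Finset.sum_le_sum fun k _ => ?_) (by positivity)
    have a1 := hK₁ k
    have a2 := hK₂ (n - k)
    have b1 := momentPoly_nonneg H.lam₁_pos H.two_lt_α₁ k hv₁
    have b2 := momentPoly_nonneg H.lam₂_pos H.two_lt_α₂ (n - k) hv₂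
    have c1 : θ₁ ≤ |T| := hT₁.trans (le_abs_self T)
    have c2 : θ₂ ≤ |T| := hT₂.trans (le_abs_self T)
    calc _ ≤ (n.choose k : ℝ) * (|T| ^ k * (K₁ k * Real.exp (δ₁ * v₁)))
          * (|T| ^ (n - k) * (K₂ (n - k) * Real.exp (δ₂ * v₂))) := by
          have := h₁ k v₁ hv₁
          have := h₂ (n - k) v₂ hv₂
          gcongr
      _ = _ := by ring

lemma tendsto_tierTerm_div (n : ℕ) {w₁ w₂ : ℝ} (hw₁ : 0 < w₁) (hr₁ : 0 < r₁) (hw₂ : 0 < w₂)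
    (hr₂ : 0 < r₂) :
    Tendsto (fun β : ℝ => H.tierTerm n (β * w₁) r₁ (β * w₂) r₂ / β ^ n) (𝓝[>] 0)
      (𝓝 (H.tierPoly n (w₁ * r₁ ^ (-H.α₁)) (r₁ ^ 2) (w₂ * r₂ ^ (-H.α₂)) (r₂ ^ 2))) := by
  have h : Tendsto (fun β : ℝ => 1 / (n.factorial : ℝ) * ∑ k ∈ Finset.range (n + 1),
      (n.choose k : ℝ) * (laplaceDiff H.lam₁ H.α₁ k (β * w₁) r₁ / β ^ k)
        * (laplaceDiff H.lam₂ H.α₂ (n - k) (β * w₂) r₂ / β ^ (n - k))) (𝓝[>] 0)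
      (𝓝 (H.tierPoly n (w₁ * r₁ ^ (-H.α₁)) (r₁ ^ 2) (w₂ * r₂ ^ (-H.α₂)) (r₂ ^ 2))) := by
    refine Tendsto.const_mul _ (tendsto_finsetSum _ fun k _ => ?_)
    exact ((tendsto_laplaceDiff_div H.lam₁_pos H.two_lt_α₁ hw₁ hr₁ k).const_mul _).mul
      (tendsto_laplaceDiff_div H.lam₂_pos H.two_lt_α₂ hw₂ hr₂ (n - k))
  refine h.congr fun β => ?_
  rw [tierTerm, mul_div_assoc, Finset.sum_div]
  congr 1
  refine Finset.sum_congr rfl fun k hk => ?_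
  have : β ^ n = β ^ k * β ^ (n - k) := by
    rw [← pow_add, Nat.add_sub_cancel' (by simpa [Nat.lt_succ_iff] using hk)]
  rw [this, div_eq_mul_inv, div_eq_mul_inv, div_eq_mul_inv, mul_inv]
  ring

lemma measurable_tierTerm (n : ℕ) {Ω : Type*} [MeasurableSpace Ω] {f₁ f₂ f₃ f₄ : Ω → ℝ}
    (h₁ : Measurable f₁) (h₂ : Measurable f₂) (h₃ : Measurable f₃) (h₄ : Measurable f₄) :
    Measurable fun ω => H.tierTerm n (f₁ ω) (f₂ ω) (f₃ ω) (f₄ ω) := by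
  have a : ∀ k, Measurable fun ω => laplaceDiff H.lam₁ H.α₁ k (f₁ ω) (f₂ ω) := fun k =>
    (measurable_laplaceDiff H.lam₁ H.α₁ k).comp (h₁.prodMk h₂)
  have b : ∀ k, Measurable fun ω => laplaceDiff H.lam₂ H.α₂ k (f₃ ω) (f₄ ω) := fun k =>
    (measurable_laplaceDiff H.lam₂ H.α₂ k).comp (h₃.prodMk h₄)
  unfold tierTerm
  fun_prop

end TwoTier

/-! ### Effect of one additional interferer -/

lemma one_sub_sum_geometric {t : ℝ} (ht : 1 + t ≠ 0) (K : ℕ) :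
    1 - ∑ q ∈ Finset.range K, t ^ q * ((1 + t) ^ (q + 1))⁻¹ = (t / (1 + t)) ^ K := by
  induction K with
  | zero => simp
  | succ K ih =>
    rw [Finset.sum_range_succ, ← sub_sub, ih, div_pow, div_pow]
    field_simp
    ring

lemma sum_multinomial_eq_sum_antidiagonal (A C : ℕ → ℝ) (t : ℝ) (n : ℕ) :
    1 / (n.factorial : ℝ) * ∑ q ∈ Finset.Nat.antidiagonalTuple 3 n,
        (Nat.multinomial Finset.univ q : ℝ) * A (q 0) * C (q 1) * Real.Gamma (q 2 + 1)
          * t ^ (q 2) * ((1 + t) ^ (q 2 + 1))⁻¹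
      = ∑ ij ∈ Finset.HasAntidiagonal.antidiagonal n, (1 / (ij.1.factorial : ℝ) *
          ∑ k ∈ Finset.range (ij.1 + 1), (ij.1.choose k : ℝ) * A k * C (ij.1 - k))
            * (t ^ ij.2 * ((1 + t) ^ (ij.2 + 1))⁻¹) := by
  simp_rw [Finset.mul_sum, Finset.sum_mul]
  rw [Finset.sum_sigma']
  refine Finset.sum_bij' (fun q _ => ⟨(q 0 + q 1, q 2), q 0⟩)
    (fun x _ => ![x.2, x.1.1 - x.2, x.1.2]) ?_ ?_ ?_ ?_ ?_
  · intro q hq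
    rw [Finset.Nat.mem_antidiagonalTuple, Fin.sum_univ_three] at hq
    simp only [Finset.mem_sigma, Finset.HasAntidiagonal.mem_antidiagonal, Finset.mem_range]
    omega
  · rintro ⟨⟨i, j⟩, k⟩ hx
    simp only [Finset.mem_sigma, Finset.HasAntidiagonal.mem_antidiagonal, Finset.mem_range] at hx
    rw [Finset.Nat.mem_antidiagonalTuple, Fin.sum_univ_three]
    simp
    omega
  · intro q _
    ext i
    fin_cases i <;> simp
  · rintro ⟨⟨i, j⟩, k⟩ hx
    simp only [Finset.mem_sigma, Finset.HasAntidiagonal.mem_antidiagonal, Finset.mem_range] at hx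
    have : k + (i - k) = i := by omega
    simp [this]
  · intro q hq
    rw [Finset.Nat.mem_antidiagonalTuple, Fin.sum_univ_three] at hq
    have hm := Nat.multinomial_spec Finset.univ q
    rw [Fin.prod_univ_three, Fin.sum_univ_three, hq] at hm
    have hm' : ((q 0).factorial * (q 1).factorial * (q 2).factorial : ℝ)
        * (Nat.multinomial Finset.univ q : ℝ) = n.factorial := by exact_mod_cast hm
    have hc := Nat.add_choose_mul_factorial_mul_factorial (q 0) (q 1)
    rw [← Nat.choose_symm_add] at hc
    have hc' : ((q 0 + q 1).choose (q 0) : ℝ) * (q 0).factorial * (q 1).factorial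
        = (q 0 + q 1).factorial := by exact_mod_cast hc
    have p0 : ((q 0).factorial : ℝ) ≠ 0 := by positivity
    have p1 : ((q 1).factorial : ℝ) ≠ 0 := by positivity
    have p2 : ((q 2).factorial : ℝ) ≠ 0 := by positivity
    have pn : (n.factorial : ℝ) ≠ 0 := by positivity
    have e1 : 1 / (n.factorial : ℝ) * (Nat.multinomial Finset.univ q : ℝ) * (q 2).factorial
        = 1 / ((q 0).factorial * (q 1).factorial) := by
      rw [← hm'] at pn ⊢
      have := right_ne_zero_of_mul pn
      field_simp
    have e2 : 1 / ((q 0 + q 1).factorial : ℝ) * ((q 0 + q 1).choose (q 0) : ℝ)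
        = 1 / ((q 0).factorial * (q 1).factorial) := by
      rw [← hc']
      have : ((q 0 + q 1).choose (q 0) : ℝ) ≠ 0 := by
        exact_mod_cast (Nat.choose_pos (Nat.le_add_right _ _)).ne'
      field_simp
    simp only [Real.Gamma_nat_eq_factorial, Nat.add_sub_cancel_left]
    linear_combination (A (q 0) * C (q 1) * t ^ (q 2) * ((1 + t) ^ (q 2 + 1))⁻¹) * (e1 - e2)

lemma sum_sub_sum_convolution (c : ℕ → ℝ) {t : ℝ} (ht : 1 + t ≠ 0) (N : ℕ) :
    ∑ n ∈ Finset.range N, c n - ∑ n ∈ Finset.range N,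
        ∑ ij ∈ Finset.HasAntidiagonal.antidiagonal n,
          c ij.1 * (t ^ ij.2 * ((1 + t) ^ (ij.2 + 1))⁻¹)
      = ∑ m ∈ Finset.range N, c m * (t / (1 + t)) ^ (N - m) := by
  simp_rw [← one_sub_sum_geometric ht, mul_sub, mul_one, Finset.sum_sub_distrib,
    Finset.Nat.sum_antidiagonal_eq_sum_range_succ_mk]
  congr 1
  rw [Finset.sum_comm' (t' := Finset.range N) (s' := fun m => Finset.Ico m N)
    (by intro x y; simp only [Finset.mem_range, Finset.mem_Ico]; omega)]
  refine Finset.sum_congr rfl fun m _ => ?_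
  rw [Finset.sum_Ico_eq_sum_range, Finset.mul_sum]
  simp

/-- The loss of coverage caused by one additional exponentially distributed interference term of
mean `t`, as a positive combination of the coverage terms without it. -/
lemma sum_sub_sum_multinomial (A C : ℕ → ℝ) {t : ℝ} (ht : 1 + t ≠ 0) (N : ℕ) :
    ∑ n ∈ Finset.range N, 1 / (n.factorial : ℝ) *
        ∑ k ∈ Finset.range (n + 1), (n.choose k : ℝ) * A k * C (n - k)
      - ∑ n ∈ Finset.range N, 1 / (n.factorial : ℝ) *
        ∑ q ∈ Finset.Nat.antidiagonalTuple 3 n,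
          (Nat.multinomial Finset.univ q : ℝ) * A (q 0) * C (q 1) * Real.Gamma (q 2 + 1)
            * t ^ (q 2) * ((1 + t) ^ (q 2 + 1))⁻¹
      = ∑ m ∈ Finset.range N, (1 / (m.factorial : ℝ) *
          ∑ k ∈ Finset.range (m + 1), (m.choose k : ℝ) * A k * C (m - k))
            * (t / (1 + t)) ^ (N - m) := by
  simp_rw [sum_multinomial_eq_sum_antidiagonal]
  exact sum_sub_sum_convolution _ ht N

/-! ### Leading order of parametrized integrals -/

/-- If `F β ω / βⁿ` converges to a positive limit as `β → 0⁺` and is dominated by an integrable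
function, then `∫ F β / βⁿ` converges to a positive limit. -/
lemma tendsto_integral_div_pow {Ω : Type*} [MeasurableSpace Ω] {μ : Measure Ω} (hμ : μ ≠ 0)
    {F : ℝ → Ω → ℝ} {G bound : Ω → ℝ} {n : ℕ}
    (hmeas : ∀ β, 0 < β → AEStronglyMeasurable (F β) μ)
    (hbound : ∀ β, 0 < β → ∀ᵐ ω ∂μ, |F β ω| ≤ β ^ n * bound ω)
    (hint : Integrable bound μ)
    (hlim : ∀ᵐ ω ∂μ, Tendsto (fun β => F β ω / β ^ n) (𝓝[>] 0) (𝓝 (G ω)))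
    (hpos : ∀ᵐ ω ∂μ, 0 < G ω) :
    ∃ c : ℝ, 0 < c ∧ Tendsto (fun β => (∫ ω, F β ω ∂μ) / β ^ n) (𝓝[>] 0) (𝓝 c) := by
  have hmeas' : ∀ᶠ β in 𝓝[>] (0 : ℝ), AEStronglyMeasurable (fun ω => F β ω / β ^ n) μ := by
    filter_upwards [self_mem_nhdsWithin] with β hβ
    exact (hmeas β hβ).div₀ aestronglyMeasurable_const
  have hb : ∀ β : ℝ, 0 < β → ∀ᵐ ω ∂μ, ‖F β ω / β ^ n‖ ≤ bound ω := by
    intro β hβ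
    filter_upwards [hbound β hβ] with ω hω
    rw [norm_div, Real.norm_eq_abs, Real.norm_eq_abs, abs_of_pos (pow_pos hβ n),
      div_le_iff₀ (pow_pos hβ n)]
    linarith
  have hT := tendsto_integral_filter_of_dominated_convergence bound hmeas'
    (by filter_upwards [self_mem_nhdsWithin] with β hβ using hb β hβ) hint hlim
  have hseq : Tendsto (fun k : ℕ => 1 / ((k : ℝ) + 1)) atTop (𝓝[>] 0) :=
    tendsto_nhdsWithin_iff.2 ⟨tendsto_one_div_add_atTop_nhds_zero_nat,
      Eventually.of_forall fun k => by simp only [mem_Ioi]; positivity⟩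
  have hGmeas : AEStronglyMeasurable G μ := by
    refine aestronglyMeasurable_of_tendsto_ae atTop
      (f := fun (k : ℕ) ω => F (1 / ((k : ℝ) + 1)) ω / (1 / ((k : ℝ) + 1)) ^ n) (fun k => ?_) ?_
    · exact (hmeas _ (by positivity)).div₀ aestronglyMeasurable_const
    · filter_upwards [hlim] with ω hω using hω.comp hseq
  have hGint : Integrable G μ := by
    refine hint.mono' hGmeas ?_
    have hall : ∀ᵐ ω ∂μ, ∀ k : ℕ,
        ‖F (1 / ((k : ℝ) + 1)) ω / (1 / ((k : ℝ) + 1)) ^ n‖ ≤ bound ω :=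
      ae_all_iff.2 fun k => hb _ (by positivity)
    filter_upwards [hlim, hall] with ω hω hk
    exact le_of_tendsto (hω.comp hseq).norm (Eventually.of_forall hk)
  refine ⟨∫ ω, G ω ∂μ, ?_, ?_⟩
  · rw [integral_pos_iff_support_of_nonneg_ae (hpos.mono fun ω h => h.le) hGint]
    have : Function.support G =ᵐ[μ] univ := by
      filter_upwards [hpos] with ω hω
      exact propext ⟨fun _ => trivial, fun _ => hω.ne'⟩
    rw [measure_congr this]
    exact Measure.measure_univ_pos.2 hμ
  · simpa only [integral_div] using hT

/-! ### The SIR threshold near zero rate -/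

lemma tendsto_sirThreshold_div {a : ℝ} :
    Tendsto (fun τ : ℝ => sirThreshold (a * τ) / τ) (𝓝[>] 0) (𝓝 (a * Real.log 2)) := by
  have h : HasDerivAt (fun τ : ℝ => sirThreshold (a * τ)) (a * Real.log 2) 0 := by
    have h1 : HasDerivAt (fun τ : ℝ => a * τ) a 0 := by
      simpa using (hasDerivAt_id (0 : ℝ)).const_mul a
    have h2 := (h1.const_rpow (a := 2) (by norm_num)).sub_const 1
    simpa [sirThreshold, mul_comm] using h2
  have h2 := h.tendsto_slope_zero_right
  refine h2.congr fun τ => ?_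
  simp [sirThreshold, div_eq_inv_mul]

lemma sirThreshold_pos {x : ℝ} (hx : 0 < x) : 0 < sirThreshold x := by
  have := Real.one_lt_rpow (x := 2) (by norm_num) hx
  unfold sirThreshold
  linarith

/-- Leading-order behaviour in the SIR threshold transfers to the rate threshold. -/
lemma thetaAtZero_comp_sirThreshold {g : ℝ → ℝ} {n : ℕ} {a c : ℝ} (ha : 0 < a) (hc : 0 < c)
    (h : Tendsto (fun β => g β / β ^ n) (𝓝[>] 0) (𝓝 c)) :
    ThetaAtZero (fun τ => g (sirThreshold (a * τ))) (fun τ => τ ^ n) := by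
  have hlog : 0 < Real.log 2 := Real.log_pos (by norm_num)
  refine ⟨c * (a * Real.log 2) ^ n, by positivity, ?_⟩
  have h0 : Tendsto (fun τ : ℝ => sirThreshold (a * τ)) (𝓝[>] 0) (𝓝[>] 0) := by
    refine tendsto_nhdsWithin_iff.2 ⟨?_, ?_⟩
    · have : ContinuousAt (fun τ : ℝ => sirThreshold (a * τ)) 0 := by
        unfold sirThreshold
        refine ContinuousAt.sub (ContinuousAt.rpow continuousAt_const (by fun_prop)
          (Or.inl (by norm_num))) continuousAt_const
      have h := this.tendsto.mono_left (nhdsWithin_le_nhds (s := Ioi 0))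
      simpa [sirThreshold] using h
    · filter_upwards [self_mem_nhdsWithin] with τ hτ
      exact sirThreshold_pos (mul_pos ha hτ)
  refine ((h.comp h0).mul (tendsto_sirThreshold_div (a := a).pow n)).congr' ?_
  filter_upwards [self_mem_nhdsWithin] with τ hτ
  have hτ : 0 < τ := hτ
  have := sirThreshold_pos (mul_pos ha hτ)
  simp only [Function.comp]
  rw [div_pow]
  field_simp

/-! ### Positivity of the association probabilities -/

lemma isFiniteMeasure_nearestLaw {lam : ℝ} (hlam : 0 < lam) :
    IsFiniteMeasure (nearestLaw lam) := by
  have hpi := Real.pi_pos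
  refine isFiniteMeasure_withDensity_ofReal (Integrable.restrict ?_).2
  have h := (integrable_mul_exp_neg_mul_sq (b := Real.pi * lam) (by positivity)).const_mul
    (2 * Real.pi * lam)
  refine h.congr (Eventually.of_forall fun r => ?_)
  simp only [neg_mul]
  ring

lemma absolutelyContinuous_nearestLaw {lam : ℝ} (hlam : 0 < lam) :
    volume.restrict (Ioi 0) ≪ nearestLaw lam := by
  have hpi := Real.pi_pos
  refine withDensity_absolutelyContinuous' (by fun_prop) ?_
  filter_upwards [self_mem_ae_restrict measurableSet_Ioi] with r hr
  have hr : 0 < r := hr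
  simp only [ne_eq, ENNReal.ofReal_eq_zero, not_le]
  positivity

variable (H : HetNet)

/-- A set containing a nonempty open subset of the open quadrant has positive probability. -/
lemma distLaw_real_pos {S O : Set (ℝ × ℝ)} (hO : IsOpen O) (hne : O.Nonempty)
    (hquad : O ⊆ Ioi 0 ×ˢ Ioi 0) (hOS : O ⊆ S) : 0 < H.distLaw.real S := by
  have := isFiniteMeasure_nearestLaw H.lam₁_pos
  have := isFiniteMeasure_nearestLaw H.lam₂_pos
  have hac : (volume.restrict (Ioi 0)).prod (volume.restrict (Ioi 0)) ≪ H.distLaw :=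
    (absolutelyContinuous_nearestLaw H.lam₁_pos).prod (absolutelyContinuous_nearestLaw H.lam₂_pos)
  have : IsFiniteMeasure H.distLaw := by unfold distLaw; infer_instance
  refine ENNReal.toReal_pos (fun h0 => ?_) (measure_ne_top _ _)
  have h1 := hac (measure_mono_null hOS h0)
  rw [Measure.prod_restrict, Measure.restrict_apply hO.measurableSet,
    inter_eq_left.2 hquad] at h1
  exact (hO.measure_pos volume hne).ne' h1

/-- The distance of the nearest pico base station at which its received power, multiplied by `c`,
equals the received power of a macro base station at distance `x`. -/
noncomputable def balanceDist (c x : ℝ) : ℝ := (c * H.P₂ / H.P₁) ^ (1 / H.α₂) * x ^ (H.α₁ / H.α₂)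

lemma P₁_pos : 0 < H.P₁ := H.P₂_pos.trans H.P₂_lt_P₁

lemma balanceDist_pos {c x : ℝ} (hc : 0 < c) (hx : 0 < x) : 0 < H.balanceDist c x := by
  have := H.P₁_pos
  have := H.P₂_pos
  unfold balanceDist
  positivity

lemma balanceDist_lt {c d x : ℝ} (hc : 0 < c) (hcd : c < d) (hx : 0 < x) :
    H.balanceDist c x < H.balanceDist d x := by
  have := H.P₁_pos
  have := H.P₂_pos
  have := H.two_lt_α₂
  unfold balanceDist
  refine mul_lt_mul_of_pos_right (Real.rpow_lt_rpow (by positivity) ?_ (by positivity))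
    (by positivity)
  gcongr

lemma balanceDist_rpow_neg {c x : ℝ} (hc : 0 < c) (hx : 0 < x) :
    H.balanceDist c x ^ (-H.α₂) = H.P₁ / (c * H.P₂) * x ^ (-H.α₁) := by
  have h1 := H.P₁_pos
  have h2 := H.P₂_pos
  have h3 : H.α₂ ≠ 0 := by linarith [H.two_lt_α₂]
  rw [balanceDist, Real.mul_rpow (by positivity) (by positivity), ← Real.rpow_mul (by positivity),
    ← Real.rpow_mul hx.le]
  have e1 : 1 / H.α₂ * -H.α₂ = -1 := by field_simp
  have e2 : H.α₁ / H.α₂ * -H.α₂ = -H.α₁ := by field_simp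
  rw [e1, e2, Real.rpow_neg_one, inv_div]

lemma continuous_balanceDist (c : ℝ) : Continuous (H.balanceDist c) := by
  have := H.two_lt_α₁
  have := H.two_lt_α₂
  exact continuous_const.mul (Real.continuous_rpow_const (by positivity))

/-- Below the balance distance the pico signal, multiplied by `c`, is stronger. -/
lemma lt_of_lt_balanceDist {c x y : ℝ} (hc : 0 < c) (hx : 0 < x) (hy : 0 < y)
    (h : y < H.balanceDist c x) : H.P₁ * x ^ (-H.α₁) < c * H.P₂ * y ^ (-H.α₂) := by
  have h2 := H.P₂_pos
  have h3 := Real.rpow_lt_rpow_of_neg hy h (z := -H.α₂) (by linarith [H.two_lt_α₂])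
  rwa [H.balanceDist_rpow_neg hc hx, div_mul_eq_mul_div, div_lt_iff₀' (by positivity)] at h3

/-- Beyond the balance distance the macro signal is stronger. -/
lemma lt_of_balanceDist_lt {c x y : ℝ} (hc : 0 < c) (hx : 0 < x)
    (h : H.balanceDist c x < y) : c * H.P₂ * y ^ (-H.α₂) < H.P₁ * x ^ (-H.α₁) := by
  have h2 := H.P₂_pos
  have h3 := Real.rpow_lt_rpow_of_neg (H.balanceDist_pos hc hx) h (z := -H.α₂)
    (by linarith [H.two_lt_α₂])
  rwa [H.balanceDist_rpow_neg hc hx, div_mul_eq_mul_div, lt_div_iff₀' (by positivity)] at h3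

/-- The interior of the offloading region. -/
def offloadInterior : Set (ℝ × ℝ) :=
  {z | 0 < z.1 ∧ H.balanceDist 1 z.1 < z.2 ∧ z.2 < H.balanceDist H.B z.1}

lemma isOpen_offloadInterior : IsOpen H.offloadInterior := by
  have h1 := (H.continuous_balanceDist 1).comp (continuous_fst (X := ℝ) (Y := ℝ))
  have hB := (H.continuous_balanceDist H.B).comp (continuous_fst (X := ℝ) (Y := ℝ))
  exact (isOpen_lt continuous_const continuous_fst).inter
    ((isOpen_lt h1 continuous_snd).inter (isOpen_lt continuous_snd hB))

lemma offloadInterior_nonempty : H.offloadInterior.Nonempty := by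
  obtain ⟨y, h1, h2⟩ := exists_between (H.balanceDist_lt one_pos H.one_lt_B one_pos)
  exact ⟨(1, y), one_pos, h1, h2⟩

lemma A₂O_pos : 0 < H.A₂O := by
  refine H.distLaw_real_pos H.isOpen_offloadInterior H.offloadInterior_nonempty ?_ ?_
  · rintro ⟨x, y⟩ ⟨hx, h1, -⟩
    exact ⟨hx, (H.balanceDist_pos one_pos hx).trans h1⟩
  · rintro ⟨x, y⟩ ⟨hx, h1, h2⟩
    have hy : 0 < y := (H.balanceDist_pos one_pos hx).trans h1
    have a := H.lt_of_balanceDist_lt one_pos hx h1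
    rw [one_mul] at a
    exact ⟨a.le, H.lt_of_lt_balanceDist (one_pos.trans H.one_lt_B) hx hy h2⟩

lemma A₁_pos : 0 < H.A₁ := by
  have hB : 0 < H.B := one_pos.trans H.one_lt_B
  have h := (H.continuous_balanceDist H.B).comp (continuous_fst (X := ℝ) (Y := ℝ))
  refine H.distLaw_real_pos (O := {z | 0 < z.1 ∧ H.balanceDist H.B z.1 < z.2})
    ((isOpen_lt continuous_const continuous_fst).inter (isOpen_lt h continuous_snd))
    ⟨(1, H.balanceDist H.B 1 + 1), one_pos, lt_add_one _⟩ ?_ ?_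
  · rintro ⟨x, y⟩ ⟨hx, h1⟩
    exact ⟨hx, (H.balanceDist_pos hB hx).trans h1⟩
  · rintro ⟨x, y⟩ ⟨hx, h1⟩
    exact (H.lt_of_balanceDist_lt hB hx h1).le

lemma A₂_pos : 0 < H.A₂ := add_pos_of_pos_of_nonneg H.A₂O_pos measureReal_nonneg

lemma κ_pos : 0 < H.κ := by
  have := H.A₂O_pos
  have := H.A₂_pos
  have := H.lam₁_pos
  have := H.lam₂_pos
  unfold κ
  positivity

/-! ### The negative binomial distribution of the number of active offloaded users -/

lemma ring_choose_eq_Gamma {a : ℝ} (ha : 0 < a) (n : ℕ) :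
    Ring.choose (a + n - 1) n = Real.Gamma (n + a) / (Real.Gamma a * n.factorial) := by
  have hG : ∀ n : ℕ, Real.Gamma (n + a) = Real.Gamma a * (ascPochhammer ℝ n).eval a := by
    intro n
    induction n with
    | zero => simp
    | succ n ih =>
      have : ((n + 1 : ℕ) : ℝ) + a = (n + a) + 1 := by push_cast; ring
      rw [this, Real.Gamma_add_one (by positivity), ih, ascPochhammer_succ_eval]
      ring
  have h := Ring.factorial_nsmul_multichoose_eq_ascPochhammer a n
  rw [nsmul_eq_mul, Polynomial.ascPochhammer_smeval_eq_eval] at h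
  have hch : Ring.choose (a + n - 1) n = Ring.multichoose a n := by
    rw [Ring.choose]; congr 1; ring
  have := (Real.Gamma_pos_of_pos ha).ne'
  have hf : (n.factorial : ℝ) ≠ 0 := by positivity
  rw [hch, hG n, ← h]
  field_simp

/-- The negative binomial series. -/
lemma hasSum_negBinomial {a x : ℝ} (ha : 0 < a) (hx : 0 ≤ x) (hx1 : x < 1) :
    HasSum (fun n : ℕ => Real.Gamma (n + a) / (Real.Gamma a * n.factorial) * x ^ n)
      (1 / (1 - x) ^ a) := by
  have h := (Real.one_div_one_sub_rpow_hasFPowerSeriesOnBall_zero a).hasSum (y := x)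
    (by simp [enorm_eq_nnnorm, ← NNReal.coe_lt_one, abs_of_nonneg hx, hx1])
  simpa [FormalMultilinearSeries.ofScalars_apply_eq, ring_choose_eq_Gamma ha, mul_comm] using h

lemma pmfActive_pos (n : ℕ) : 0 < H.pmfActive n := by
  have := H.κ_pos
  have h1 : 0 < Real.Gamma ((n : ℝ) + 3.5) := Real.Gamma_pos_of_pos (by positivity)
  have h2 : 0 < Real.Gamma (3.5 : ℝ) := Real.Gamma_pos_of_pos (by norm_num)
  unfold pmfActive
  positivity

lemma hasSum_pmfActive : HasSum H.pmfActive 1 := by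
  have hκ := H.κ_pos
  have hx1 : H.κ / (3.5 + H.κ) < 1 := by rw [div_lt_one (by positivity)]; linarith
  have h := (hasSum_negBinomial (a := 3.5) (by norm_num) (by positivity) hx1).mul_left
    ((3.5 : ℝ) ^ (3.5 : ℝ) * (3.5 + H.κ) ^ (-(3.5 : ℝ)))
  have hval : (3.5 : ℝ) ^ (3.5 : ℝ) * (3.5 + H.κ) ^ (-(3.5 : ℝ))
      * (1 / (1 - H.κ / (3.5 + H.κ)) ^ (3.5 : ℝ)) = 1 := by
    have : 1 - H.κ / (3.5 + H.κ) = 3.5 / (3.5 + H.κ) := by field_simp; ring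
    rw [this, Real.div_rpow (by norm_num) (by positivity), Real.rpow_neg (by positivity)]
    have : (0 : ℝ) < (3.5 : ℝ) ^ (3.5 : ℝ) := by positivity
    have : (0 : ℝ) < (3.5 + H.κ) ^ (3.5 : ℝ) := by positivity
    field_simp
  rw [hval] at h
  refine h.congr_fun fun n => ?_
  rw [pmfActive, neg_add, Real.rpow_add (by positivity), Real.rpow_neg (by positivity) (n : ℝ),
    Real.rpow_natCast, div_pow]
  field_simp

lemma summable_pmfActive_add (U : ℕ) : Summable fun k => H.pmfActive (U + k) := by
  simpa [add_comm] using (summable_nat_add_iff U).2 H.hasSum_pmfActive.summable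

/-- The tail `∑_{u ≥ U} p_u` of the distribution of the number of active offloaded users. -/
noncomputable def tailActive (U : ℕ) : ℝ := ∑' k : ℕ, H.pmfActive (U + k)

lemma tailActive_pos (U : ℕ) : 0 < H.tailActive U :=
  (H.summable_pmfActive_add U).tsum_pos (fun _ => (H.pmfActive_pos _).le) 0 (H.pmfActive_pos _)

lemma tailActive_eq (U : ℕ) : H.tailActive U = 1 - ∑ n ∈ Finset.range U, H.pmfActive n := by
  rw [← H.hasSum_pmfActive.tsum_eq, ← H.hasSum_pmfActive.summable.sum_add_tsum_nat_add U,
    tailActive, add_sub_cancel_left]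
  simp_rw [add_comm U]

lemma pmfIN_of_lt {U n : ℕ} (h : n < U) : H.pmfIN U n = H.pmfActive n := if_pos h

lemma pmfIN_self (U : ℕ) : H.pmfIN U U = H.tailActive U := if_neg (lt_irrefl U)

/-- The number of active offloaded users seen by an offloaded user is size-biased. -/
lemma pmfActiveHat_eq {n : ℕ} (hn : 1 ≤ n) : H.pmfActiveHat n = n * H.pmfActive n / H.κ := by
  have hκ := H.κ_pos
  obtain ⟨m, rfl⟩ : ∃ m, n = m + 1 := ⟨n - 1, by omega⟩
  unfold pmfActiveHat pmfActive
  have h2 : 0 < Real.Gamma (3.5 : ℝ) := Real.Gamma_pos_of_pos (by norm_num)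
  rw [Nat.factorial_succ, Nat.cast_succ, Real.Gamma_nat_eq_factorial, Nat.add_sub_cancel, pow_succ]
  push_cast
  have : (m.factorial : ℝ) ≠ 0 := by positivity
  field_simp

lemma pmfActive_zero : H.pmfActive 0 = (1 + H.κ / 3.5) ^ (-3.5 : ℝ) := by
  have hκ := H.κ_pos
  have h2 : Real.Gamma (3.5 : ℝ) ≠ 0 := (Real.Gamma_pos_of_pos (by norm_num)).ne'
  have : 1 + H.κ / 3.5 = (3.5 + H.κ) / 3.5 := by field_simp
  rw [this, Real.div_rpow (by positivity) (by norm_num),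
    Real.rpow_neg (show (0 : ℝ) ≤ 3.5 by norm_num)]
  simp only [pmfActive, Nat.cast_zero, zero_add, Nat.factorial_zero, Nat.cast_one, mul_one,
    pow_zero]
  field_simp

/-- `q(U) = κ⁻¹ ∑ₙ min(U, n) pₙ`, with the sum over `n > U` expressed by the tail. -/
lemma probIN_eq (U : ℕ) : H.probIN U
    = (U * H.tailActive (U + 1) + ∑ n ∈ Finset.Icc 1 U, n * H.pmfActive n) / H.κ := by
  have hκ := H.κ_pos
  have e1 : (U : ℝ) * H.lam₁ * H.A₂ / (H.lam₂ * H.A₂O) = U / H.κ := by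
    unfold κ; rw [div_div_eq_mul_div]; ring
  have e2 : H.lam₂ * H.A₂O / (3.5 * H.lam₁ * H.A₂) = H.κ / 3.5 := by
    unfold κ; rw [div_div]; congr 1; ring
  have e3 : ∑ n ∈ Finset.Icc 1 U, (U : ℝ) / n * H.pmfActiveHat n
      = (∑ n ∈ Finset.Icc 1 U, H.pmfActive n) * (U / H.κ) := by
    rw [Finset.sum_mul]
    refine Finset.sum_congr rfl fun n hn => ?_
    have hn := (Finset.mem_Icc.1 hn).1
    have : (n : ℝ) ≠ 0 := by positivity
    rw [H.pmfActiveHat_eq hn]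
    field_simp
  have e4 : ∑ n ∈ Finset.Icc 1 U, H.pmfActiveHat n
      = (∑ n ∈ Finset.Icc 1 U, n * H.pmfActive n) / H.κ := by
    rw [Finset.sum_div]
    exact Finset.sum_congr rfl fun n hn => H.pmfActiveHat_eq (Finset.mem_Icc.1 hn).1
  have e5 : H.tailActive (U + 1) = 1 - H.pmfActive 0 - ∑ n ∈ Finset.Icc 1 U, H.pmfActive n := by
    rw [tailActive_eq, Finset.sum_range_succ', Finset.range_eq_Ico, Finset.sum_Ico_add',
      zero_add]
    have : Finset.Ico 1 (U + 1) = Finset.Icc 1 U := by ext; simp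
    rw [this]; ring
  rw [probIN, e1, e2, ← pmfActive_zero, e3, e4, e5]
  ring

/-- Raising the number of degrees of freedom from `U` to `U + 1` raises the selection
probability by the probability that it matters, divided by `κ`. -/
lemma probIN_succ_sub (U : ℕ) :
    H.probIN (U + 1) - H.probIN U = H.tailActive (U + 1) / H.κ := by
  have h : H.tailActive (U + 1 + 1) = H.tailActive (U + 1) - H.pmfActive (U + 1) := by
    rw [tailActive_eq, tailActive_eq, Finset.sum_range_succ _ (U + 1)]; ring
  rw [probIN_eq, probIN_eq, h, Finset.sum_Icc_succ_top (by omega)]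
  push_cast
  ring

/-! ### Macro-users -/

/-- The integrand of the macro coverage probability that belongs to the `n`-th coverage term. -/
noncomputable def macroIntegrand (n : ℕ) (β y : ℝ) : ℝ :=
  H.tierTerm n (β * y ^ H.α₁) y (β * y ^ H.α₁ * (H.ρ₂ / H.ρ₁)) (H.balanceDist H.B y) * H.fY₁ y

lemma measurable_macroIntegrand (n : ℕ) (β : ℝ) : Measurable (H.macroIntegrand n β) := by
  have h : Measurable H.fY₁ := by unfold fY₁; fun_prop
  refine (H.measurable_tierTerm n ?_ ?_ ?_ (H.continuous_balanceDist H.B).measurable).mul h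
  all_goals fun_prop

lemma fY₁_pos {y : ℝ} (hy : 0 < y) : 0 < H.fY₁ y := by
  have := H.A₁_pos
  have := H.lam₁_pos
  have := Real.pi_pos
  unfold fY₁
  positivity

lemma fY₁_eq {y : ℝ} (hy : 0 < y) : H.fY₁ y = 2 * Real.pi * H.lam₁ / H.A₁ * y
    * Real.exp (-(Real.pi * (H.lam₁ * y ^ 2 + H.lam₂ * H.balanceDist H.B y ^ 2))) := by
  have h1 := H.P₁_pos
  have h2 := H.P₂_pos
  have hB : 0 < H.B := one_pos.trans H.one_lt_B
  have e : H.balanceDist H.B y ^ 2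
      = (H.P₂ * H.B / H.P₁) ^ (2 / H.α₂) * y ^ (2 * H.α₁ / H.α₂) := by
    rw [balanceDist, mul_pow, ← Real.rpow_mul_natCast (by positivity),
      ← Real.rpow_mul_natCast hy.le, mul_comm H.B]
    push_cast
    ring_nf
  rw [fY₁, e]
  ring_nf

/-- The value of `s₂ r₂ ^ (-α₂) / β` for a macro-user; it does not depend on the distance. -/
noncomputable def macroRatio : ℝ := H.ρ₂ / H.ρ₁ * (H.P₁ / (H.B * H.P₂))

lemma macroRatio_pos : 0 < H.macroRatio := by
  have := H.P₁_pos
  have := H.P₂_pos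
  have := H.ρ₁_pos
  have := H.ρ₂_pos
  have := H.one_lt_B
  unfold macroRatio
  positivity

/-- For a macro-user `s₁ r₁ ^ (-α₁) = β`; here both sides are divided by `β`. -/
lemma rpow_mul_rpow_neg_serving {y : ℝ} (hy : 0 < y) : y ^ H.α₁ * y ^ (-H.α₁) = 1 := by
  rw [← Real.rpow_add hy, add_neg_cancel, Real.rpow_zero]

lemma rpow_mul_balanceDist_rpow_neg {y : ℝ} (hy : 0 < y) :
    y ^ H.α₁ * (H.ρ₂ / H.ρ₁) * H.balanceDist H.B y ^ (-H.α₂) = H.macroRatio := by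
  rw [H.balanceDist_rpow_neg (one_pos.trans H.one_lt_B) hy, macroRatio]
  linear_combination (H.ρ₂ / H.ρ₁ * (H.P₁ / (H.B * H.P₂))) * H.rpow_mul_rpow_neg_serving hy

lemma macroIntegrand_nonneg (n : ℕ) {β y : ℝ} (hβ : 0 < β) (hy : 0 < y) :
    0 ≤ H.macroIntegrand n β y := by
  have := H.ρ₁_pos
  have := H.ρ₂_pos
  exact mul_nonneg (H.tierTerm_nonneg n (by positivity) hy (by positivity)
    (H.balanceDist_pos (one_pos.trans H.one_lt_B) hy)) (H.fY₁_pos hy).le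

/-- The exponential growth allowed for `tierPoly` is absorbed by the density `fY₁`: the rate in
`v₂` is absorbed entirely, the one in `v₁ = y²` leaves half of the Gaussian decay. -/
lemma exists_macroIntegrand_bound (n : ℕ) : ∃ b : ℝ → ℝ, IntegrableOn b (Ioi 0) ∧
    ∀ β, 0 < β → ∀ y, 0 < y → H.macroIntegrand n β y ≤ β ^ n * b y := by
  have hpi := Real.pi_pos
  have hl₁ := H.lam₁_pos
  have hl₂ := H.lam₂_pos
  have hρ₁ := H.ρ₁_pos
  have hρ₂ := H.ρ₂_pos
  have hA := H.A₁_pos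
  have hR := H.macroRatio_pos
  obtain ⟨K, hK, hle⟩ := H.exists_tierPoly_le n (δ₁ := Real.pi * H.lam₁ / 2)
    (δ₂ := Real.pi * H.lam₂) (T := max 1 H.macroRatio) (by positivity) (by positivity)
  refine ⟨fun y => K * (2 * Real.pi * H.lam₁ / H.A₁)
    * (y * Real.exp (-(Real.pi * H.lam₁ / 2) * y ^ 2)), ?_, fun β hβ y hy => ?_⟩
  · exact ((integrable_mul_exp_neg_mul_sq (by positivity)).const_mul _).integrableOn
  · have hd := H.balanceDist_pos (one_pos.trans H.one_lt_B) hy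
    have h1 := H.tierTerm_le n (s₁ := β * y ^ H.α₁) (s₂ := β * y ^ H.α₁ * (H.ρ₂ / H.ρ₁))
      (by positivity) hy (by positivity) hd
    have e1 : β * y ^ H.α₁ * y ^ (-H.α₁) = β * 1 := by
      rw [mul_assoc, H.rpow_mul_rpow_neg_serving hy]
    have e2 : β * y ^ H.α₁ * (H.ρ₂ / H.ρ₁) * H.balanceDist H.B y ^ (-H.α₂)
        = β * H.macroRatio := by
      rw [← H.rpow_mul_balanceDist_rpow_neg hy]; ring
    rw [e1, e2, tierPoly_smul] at h1
    have h2 := hle 1 (y ^ 2) H.macroRatio (H.balanceDist H.B y ^ 2) zero_le_one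
      (le_max_left _ _) hR.le (le_max_right _ _) (by positivity) (by positivity)
    have h3 : H.macroIntegrand n β y ≤ β ^ n * (K * (Real.exp (Real.pi * H.lam₁ / 2 * y ^ 2)
        * Real.exp (Real.pi * H.lam₂ * H.balanceDist H.B y ^ 2))) * H.fY₁ y :=
      mul_le_mul_of_nonneg_right (h1.trans (mul_le_mul_of_nonneg_left h2 (by positivity)))
        (H.fY₁_pos hy).le
    refine h3.trans (le_of_eq ?_)
    have e3 : Real.exp (-(Real.pi * H.lam₁ / 2) * y ^ 2)
        = Real.exp (Real.pi * H.lam₁ / 2 * y ^ 2)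
          * Real.exp (Real.pi * H.lam₂ * H.balanceDist H.B y ^ 2)
          * Real.exp (-(Real.pi * (H.lam₁ * y ^ 2 + H.lam₂ * H.balanceDist H.B y ^ 2))) := by
      rw [← Real.exp_add, ← Real.exp_add]; ring_nf
    beta_reduce
    rw [H.fY₁_eq hy, e3]
    ring

lemma integrableOn_macroIntegrand (n : ℕ) {β : ℝ} (hβ : 0 < β) :
    IntegrableOn (H.macroIntegrand n β) (Ioi 0) := by
  obtain ⟨b, hb, hle⟩ := H.exists_macroIntegrand_bound n
  refine (hb.const_mul (β ^ n)).mono' (H.measurable_macroIntegrand n β).aestronglyMeasurable ?_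
  filter_upwards [self_mem_ae_restrict measurableSet_Ioi] with y hy
  rw [Real.norm_eq_abs, abs_of_nonneg (H.macroIntegrand_nonneg n hβ hy)]
  exact hle β hβ y hy

/-- The `n`-th coverage term of a macro-user is of exact order `βⁿ`. -/
lemma exists_tendsto_integral_macroIntegrand (n : ℕ) : ∃ c : ℝ, 0 < c ∧
    Tendsto (fun β => (∫ y in Ioi (0 : ℝ), H.macroIntegrand n β y) / β ^ n) (𝓝[>] 0) (𝓝 c) := by
  obtain ⟨b, hb, hle⟩ := H.exists_macroIntegrand_bound n
  have hρ₁ := H.ρ₁_pos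
  have hρ₂ := H.ρ₂_pos
  have hB : 0 < H.B := one_pos.trans H.one_lt_B
  have hae := self_mem_ae_restrict (μ := (volume : Measure ℝ)) (measurableSet_Ioi (a := (0 : ℝ)))
  refine tendsto_integral_div_pow (bound := b)
    (G := fun y => H.tierPoly n 1 (y ^ 2) H.macroRatio (H.balanceDist H.B y ^ 2) * H.fY₁ y)
    ?_ (fun β _ => (H.measurable_macroIntegrand n β).aestronglyMeasurable) ?_ hb ?_ ?_
  · simp [Measure.restrict_eq_zero]
  · intro β hβ
    filter_upwards [hae] with y hy
    rw [abs_of_nonneg (H.macroIntegrand_nonneg n hβ hy)]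
    exact hle β hβ y hy
  · filter_upwards [hae] with y hy
    have hy : 0 < y := hy
    have h := (H.tendsto_tierTerm_div n (w₁ := y ^ H.α₁) (w₂ := y ^ H.α₁ * (H.ρ₂ / H.ρ₁))
      (by positivity) hy (by positivity) (H.balanceDist_pos hB hy)).mul_const (H.fY₁ y)
    rw [H.rpow_mul_rpow_neg_serving hy, H.rpow_mul_balanceDist_rpow_neg hy] at h
    refine h.congr fun β => ?_
    rw [macroIntegrand, div_mul_eq_mul_div, ← mul_assoc β]
  · filter_upwards [hae] with y hy
    have hy : 0 < y := hy
    exact mul_pos (H.tierPoly_pos n one_pos (by positivity) H.macroRatio_pos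
      (pow_pos (H.balanceDist_pos hB hy) 2)) (H.fY₁_pos hy)

lemma S₁_eq (U : ℕ) {β : ℝ} (hβ : 0 < β) :
    H.S₁ U β = ∑ u ∈ Finset.range (U + 1), (∑ n ∈ Finset.range (H.N₁ - u),
      ∫ y in Ioi (0 : ℝ), H.macroIntegrand n β y) * H.pmfIN U u := by
  unfold S₁
  refine Finset.sum_congr rfl fun u _ => ?_
  rw [← integral_finsetSum _ fun n _ => H.integrableOn_macroIntegrand n hβ]
  simp_rw [macroIntegrand, ← Finset.sum_mul, tierTerm, balanceDist, mul_comm H.P₂ H.B]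

/-- One more degree of freedom for interference nulling costs the macro-user precisely the
coverage term of index `N₁ - (U + 1)`. -/
lemma S₁_succ_sub {U : ℕ} (hU : U + 1 < H.N₁) {β : ℝ} (hβ : 0 < β) :
    H.S₁ (U + 1) β - H.S₁ U β = -(H.tailActive (U + 1)
      * ∫ y in Ioi (0 : ℝ), H.macroIntegrand (H.N₁ - (U + 1)) β y) := by
  rw [H.S₁_eq _ hβ, H.S₁_eq _ hβ, Finset.sum_range_succ _ (U + 1), Finset.sum_range_succ _ U,
    Finset.sum_range_succ _ U, H.pmfIN_self, H.pmfIN_self, H.pmfIN_of_lt (Nat.lt_succ_self U)]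
  have e : ∀ f : ℕ → ℝ, ∑ u ∈ Finset.range U, f u * H.pmfIN (U + 1) u
      = ∑ u ∈ Finset.range U, f u * H.pmfIN U u := fun f =>
    Finset.sum_congr rfl fun u hu => by
      have hu := Finset.mem_range.1 hu
      rw [H.pmfIN_of_lt hu, H.pmfIN_of_lt (hu.trans (Nat.lt_succ_self U))]
  have ht : H.tailActive U = H.pmfActive U + H.tailActive (U + 1) := by
    rw [tailActive_eq, tailActive_eq, Finset.sum_range_succ]; ring
  have hN : H.N₁ - U = H.N₁ - (U + 1) + 1 := by omega
  rw [e, ht, hN, Finset.sum_range_succ _ (H.N₁ - (U + 1))]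
  ring

/-! ### Offloaded users -/

/-- The offloading region. -/
def offloadRegion : Set (ℝ × ℝ) :=
  {z | 0 < z.1 ∧ H.balanceDist 1 z.1 < z.2 ∧ z.2 ≤ H.balanceDist H.B z.1}

lemma measurableSet_offloadRegion : MeasurableSet H.offloadRegion := by
  have h1 := ((H.continuous_balanceDist 1).comp (continuous_fst (X := ℝ) (Y := ℝ))).measurable
  have hB := ((H.continuous_balanceDist H.B).comp (continuous_fst (X := ℝ) (Y := ℝ))).measurable
  exact (measurableSet_lt measurable_const measurable_fst).inter
    ((measurableSet_lt h1 measurable_snd).inter (measurableSet_le measurable_snd hB))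

lemma snd_pos_of_mem_offloadRegion {z : ℝ × ℝ} (hz : z ∈ H.offloadRegion) : 0 < z.2 :=
  (H.balanceDist_pos one_pos hz.1).trans hz.2.1

lemma volume_restrict_offloadRegion_ne_zero :
    (volume : Measure (ℝ × ℝ)).restrict H.offloadRegion ≠ 0 := by
  rw [Ne, Measure.restrict_eq_zero]
  have h := H.isOpen_offloadInterior.measure_pos volume H.offloadInterior_nonempty
  have hsub : H.offloadInterior ⊆ H.offloadRegion := fun z hz => ⟨hz.1, hz.2.1, hz.2.2.le⟩
  exact (h.trans_le (measure_mono hsub)).ne'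

lemma integral_integral_offload {F : ℝ × ℝ → ℝ} (hF : IntegrableOn F H.offloadRegion) :
    ∫ x in Ioi (0 : ℝ), ∫ y in (H.balanceDist 1 x)..(H.balanceDist H.B x), F (x, y)
      = ∫ z in H.offloadRegion, F z := by
  rw [← integral_indicator H.measurableSet_offloadRegion, Measure.volume_eq_prod,
    integral_prod _ ((integrable_indicator_iff H.measurableSet_offloadRegion).2 hF),
    ← integral_indicator measurableSet_Ioi]
  refine integral_congr_ae (Eventually.of_forall fun x => ?_)
  by_cases hx : 0 < x
  · simp only [indicator, mem_Ioi, hx, if_true]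
    rw [intervalIntegral.integral_of_le (H.balanceDist_lt one_pos H.one_lt_B hx).le,
      ← integral_indicator measurableSet_Ioc]
    refine integral_congr_ae (Eventually.of_forall fun y => ?_)
    simp [indicator, offloadRegion, hx]
  · simp [indicator, offloadRegion, hx]

/-- The ratio `t / β` of the mean interference from the nearest macro base station to the SIR
threshold. -/
noncomputable def offloadRatio (z : ℝ × ℝ) : ℝ := H.ρ₁ * z.2 ^ H.α₂ / (H.ρ₂ * z.1 ^ H.α₁)

/-- The integrand of the `m`-th coverage term of an offloaded user, weighted by the `j`-th power
of `t / (1 + t)`. -/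
noncomputable def offloadIntegrand (m j : ℕ) (β : ℝ) (z : ℝ × ℝ) : ℝ :=
  H.tierTerm m (β * z.2 ^ H.α₂ * (H.ρ₁ / H.ρ₂)) z.1 (β * z.2 ^ H.α₂) z.2
    * (β * H.offloadRatio z / (1 + β * H.offloadRatio z)) ^ j * H.fY₁Y₂ z.1 z.2

lemma measurable_offloadIntegrand (m j : ℕ) (β : ℝ) : Measurable (H.offloadIntegrand m j β) := by
  have h : Measurable fun z : ℝ × ℝ => H.fY₁Y₂ z.1 z.2 := by unfold fY₁Y₂; fun_prop
  have h' : Measurable H.offloadRatio := by unfold offloadRatio; fun_prop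
  refine ((H.measurable_tierTerm m ?_ ?_ ?_ ?_).mul ?_).mul h
  all_goals fun_prop

lemma fY₁Y₂_pos {x y : ℝ} (hx : 0 < x) (hy : 0 < y) : 0 < H.fY₁Y₂ x y := by
  have := H.A₂O_pos
  have := H.lam₁_pos
  have := H.lam₂_pos
  have := Real.pi_pos
  unfold fY₁Y₂
  positivity

lemma offloadRatio_pos {z : ℝ × ℝ} (hx : 0 < z.1) (hy : 0 < z.2) : 0 < H.offloadRatio z := by
  have := H.ρ₁_pos
  have := H.ρ₂_pos
  unfold offloadRatio
  positivity

/-- For an offloaded user `s₁ r₁ ^ (-α₁) = t`; here both sides are divided by `β`. -/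
lemma rpow_mul_rpow_neg_offload {z : ℝ × ℝ} (hx : 0 < z.1) :
    z.2 ^ H.α₂ * (H.ρ₁ / H.ρ₂) * z.1 ^ (-H.α₁) = H.offloadRatio z := by
  rw [Real.rpow_neg hx.le, offloadRatio]
  field_simp

/-- In the offloading region the biased pico signal dominates, so the macro interference is
bounded relative to the pico signal. -/
lemma offloadRatio_le {z : ℝ × ℝ} (hz : z ∈ H.offloadRegion) :
    H.offloadRatio z ≤ H.ρ₁ / H.ρ₂ * (H.B * H.P₂ / H.P₁) := by
  have hx : 0 < z.1 := hz.1
  have hy := H.snd_pos_of_mem_offloadRegion hz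
  have hB : 0 < H.B := one_pos.trans H.one_lt_B
  have h1 := H.P₁_pos
  have h2 := H.P₂_pos
  have hρ₁ := H.ρ₁_pos
  have hρ₂ := H.ρ₂_pos
  have h := Real.rpow_le_rpow_of_nonpos hy hz.2.2 (z := -H.α₂) (by linarith [H.two_lt_α₂])
  rw [H.balanceDist_rpow_neg hB hx, Real.rpow_neg hy.le, Real.rpow_neg hx.le] at h
  have hxα : 0 < z.1 ^ H.α₁ := by positivity
  have hyα : 0 < z.2 ^ H.α₂ := by positivity
  have h' : z.2 ^ H.α₂ / z.1 ^ H.α₁ ≤ H.B * H.P₂ / H.P₁ := by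
    rw [div_le_div_iff₀ hxα h1]
    field_simp at h
    linarith
  calc H.offloadRatio z = H.ρ₁ / H.ρ₂ * (z.2 ^ H.α₂ / z.1 ^ H.α₁) := by
        unfold offloadRatio; field_simp
    _ ≤ _ := by gcongr

lemma offloadIntegrand_nonneg (m j : ℕ) {β : ℝ} (hβ : 0 < β) {z : ℝ × ℝ}
    (hz : z ∈ H.offloadRegion) : 0 ≤ H.offloadIntegrand m j β z := by
  have hx : 0 < z.1 := hz.1
  have hy := H.snd_pos_of_mem_offloadRegion hz
  have := H.ρ₁_pos
  have := H.ρ₂_pos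
  have := H.offloadRatio_pos hx hy
  have := H.tierTerm_nonneg m (s₁ := β * z.2 ^ H.α₂ * (H.ρ₁ / H.ρ₂)) (s₂ := β * z.2 ^ H.α₂)
    (by positivity) hx (by positivity) hy
  have := H.fY₁Y₂_pos hx hy
  unfold offloadIntegrand
  positivity

/-- Here each exponential rate allowed for `tierPoly` uses up half of the Gaussian decay of the
density `fY₁Y₂`, and `t / (1 + t) ≤ t` is at most a constant multiple of `β`. -/
lemma exists_offloadIntegrand_bound (m j : ℕ) : ∃ b : ℝ × ℝ → ℝ,
    IntegrableOn b H.offloadRegion ∧ ∀ β, 0 < β → ∀ z ∈ H.offloadRegion,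
      H.offloadIntegrand m j β z ≤ β ^ (m + j) * b z := by
  have hpi := Real.pi_pos
  have hl₁ := H.lam₁_pos
  have hl₂ := H.lam₂_pos
  have hρ₁ := H.ρ₁_pos
  have hρ₂ := H.ρ₂_pos
  have hA := H.A₂O_pos
  set T := H.ρ₁ / H.ρ₂ * (H.B * H.P₂ / H.P₁) with hT
  obtain ⟨K, hK, hle⟩ := H.exists_tierPoly_le m (δ₁ := Real.pi * H.lam₁ / 2)
    (δ₂ := Real.pi * H.lam₂ / 2) (T := max 1 T) (by positivity) (by positivity)
  refine ⟨fun z => K * T ^ j * (4 * Real.pi ^ 2 * H.lam₁ * H.lam₂ / H.A₂O)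
    * (z.1 * Real.exp (-(Real.pi * H.lam₁ / 2) * z.1 ^ 2)
      * (z.2 * Real.exp (-(Real.pi * H.lam₂ / 2) * z.2 ^ 2))), ?_, fun β hβ z hz => ?_⟩
  · exact (((integrable_mul_exp_neg_mul_sq (by positivity)).mul_prod
      (integrable_mul_exp_neg_mul_sq (by positivity))).const_mul _).integrableOn
  · have hx : 0 < z.1 := hz.1
    have hy := H.snd_pos_of_mem_offloadRegion hz
    have hr := H.offloadRatio_pos hx hy
    have hrT := H.offloadRatio_le hz
    have hf := H.fY₁Y₂_pos hx hy
    have h1 := H.tierTerm_le m (s₁ := β * z.2 ^ H.α₂ * (H.ρ₁ / H.ρ₂)) (s₂ := β * z.2 ^ H.α₂)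
      (by positivity) hx (by positivity) hy
    have e1 : β * z.2 ^ H.α₂ * (H.ρ₁ / H.ρ₂) * z.1 ^ (-H.α₁) = β * H.offloadRatio z := by
      rw [← H.rpow_mul_rpow_neg_offload hx]; ring
    have e2 : β * z.2 ^ H.α₂ * z.2 ^ (-H.α₂) = β * 1 := by
      rw [mul_assoc, ← Real.rpow_add hy, add_neg_cancel, Real.rpow_zero]
    rw [e1, e2, tierPoly_smul] at h1
    have h2 := hle (H.offloadRatio z) (z.1 ^ 2) 1 (z.2 ^ 2) hr.le (hrT.trans (le_max_right _ _))
      zero_le_one (le_max_left _ _) (by positivity) (by positivity)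
    have h3 : (β * H.offloadRatio z / (1 + β * H.offloadRatio z)) ^ j ≤ (β * T) ^ j := by
      refine pow_le_pow_left₀ (by positivity) ?_ j
      refine (div_le_self (by positivity) ?_).trans (by gcongr)
      have : 0 < β * H.offloadRatio z := by positivity
      linarith
    have h4 : H.offloadIntegrand m j β z ≤ β ^ m * (K * (Real.exp (Real.pi * H.lam₁ / 2 * z.1 ^ 2)
        * Real.exp (Real.pi * H.lam₂ / 2 * z.2 ^ 2))) * (β * T) ^ j * H.fY₁Y₂ z.1 z.2 :=
      mul_le_mul_of_nonneg_right (mul_le_mul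
        (h1.trans (mul_le_mul_of_nonneg_left h2 (by positivity))) h3 (by positivity)
        (by positivity)) hf.le
    refine h4.trans (le_of_eq ?_)
    have e3 : Real.exp (Real.pi * H.lam₁ / 2 * z.1 ^ 2) * Real.exp (Real.pi * H.lam₂ / 2 * z.2 ^ 2)
          * Real.exp (-(Real.pi * (H.lam₁ * z.1 ^ 2 + H.lam₂ * z.2 ^ 2)))
        = Real.exp (-(Real.pi * H.lam₁ / 2) * z.1 ^ 2)
          * Real.exp (-(Real.pi * H.lam₂ / 2) * z.2 ^ 2) := by
      rw [← Real.exp_add, ← Real.exp_add, ← Real.exp_add]; ring_nf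
    rw [fY₁Y₂, pow_add, mul_pow]
    linear_combination (β ^ m * β ^ j * K * T ^ j
      * (4 * Real.pi ^ 2 * H.lam₁ * H.lam₂ / H.A₂O) * z.1 * z.2) * e3

lemma integrableOn_offloadIntegrand (m j : ℕ) {β : ℝ} (hβ : 0 < β) :
    IntegrableOn (H.offloadIntegrand m j β) H.offloadRegion := by
  obtain ⟨b, hb, hle⟩ := H.exists_offloadIntegrand_bound m j
  refine (hb.const_mul (β ^ (m + j))).mono'
    (H.measurable_offloadIntegrand m j β).aestronglyMeasurable ?_
  filter_upwards [self_mem_ae_restrict H.measurableSet_offloadRegion] with z hz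
  rw [Real.norm_eq_abs, abs_of_nonneg (H.offloadIntegrand_nonneg m j hβ hz)]
  exact hle β hβ z hz

/-- The weighted `m`-th coverage term of an offloaded user is of exact order `βᵐ⁺ʲ`. -/
lemma exists_tendsto_integral_offloadIntegrand (m j : ℕ) : ∃ c : ℝ, 0 < c ∧
    Tendsto (fun β => (∫ z in H.offloadRegion, H.offloadIntegrand m j β z) / β ^ (m + j))
      (𝓝[>] 0) (𝓝 c) := by
  obtain ⟨b, hb, hle⟩ := H.exists_offloadIntegrand_bound m j
  have hρ₁ := H.ρ₁_pos
  have hρ₂ := H.ρ₂_pos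
  have hae := self_mem_ae_restrict (μ := (volume : Measure (ℝ × ℝ))) H.measurableSet_offloadRegion
  refine tendsto_integral_div_pow (bound := b)
    (G := fun z => H.tierPoly m (H.offloadRatio z) (z.1 ^ 2) 1 (z.2 ^ 2)
      * H.offloadRatio z ^ j * H.fY₁Y₂ z.1 z.2)
    H.volume_restrict_offloadRegion_ne_zero
    (fun β _ => (H.measurable_offloadIntegrand m j β).aestronglyMeasurable) ?_ hb ?_ ?_
  · intro β hβ
    filter_upwards [hae] with z hz
    rw [abs_of_nonneg (H.offloadIntegrand_nonneg m j hβ hz)]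
    exact hle β hβ z hz
  · filter_upwards [hae] with z hz
    have hx : 0 < z.1 := hz.1
    have hy := H.snd_pos_of_mem_offloadRegion hz
    have h := H.tendsto_tierTerm_div m (w₁ := z.2 ^ H.α₂ * (H.ρ₁ / H.ρ₂)) (w₂ := z.2 ^ H.α₂)
      (by positivity) hx (by positivity) hy
    rw [H.rpow_mul_rpow_neg_offload hx, ← Real.rpow_add hy, add_neg_cancel, Real.rpow_zero] at h
    have h2 : Tendsto (fun β : ℝ => (H.offloadRatio z / (1 + β * H.offloadRatio z)) ^ j) (𝓝[>] 0)
        (𝓝 (H.offloadRatio z ^ j)) := by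
      have : ContinuousAt
          (fun β : ℝ => (H.offloadRatio z / (1 + β * H.offloadRatio z)) ^ j) 0 := by
        have : 1 + 0 * H.offloadRatio z ≠ 0 := by simp
        fun_prop (disch := assumption)
      simpa using this.tendsto.mono_left (nhdsWithin_le_nhds (s := Ioi 0))
    refine ((h.mul h2).mul_const (H.fY₁Y₂ z.1 z.2)).congr' ?_
    filter_upwards [self_mem_nhdsWithin] with β hβ
    have hβ : β ≠ 0 := ne_of_gt hβ
    rw [offloadIntegrand, pow_add, mul_div_assoc β (H.offloadRatio z), mul_pow β, ← mul_assoc β]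
    field_simp
  · filter_upwards [hae] with z hz
    have hx : 0 < z.1 := hz.1
    have hy := H.snd_pos_of_mem_offloadRegion hz
    have hr := H.offloadRatio_pos hx hy
    exact mul_pos (mul_pos (H.tierPoly_pos m hr (by positivity) one_pos (by positivity))
      (pow_pos hr j)) (H.fY₁Y₂_pos hx hy)

lemma S₂OC_eq {β : ℝ} (hβ : 0 < β) : H.S₂OC β
    = ∑ n ∈ Finset.range H.N₂, ∫ z in H.offloadRegion, H.offloadIntegrand n 0 β z := by
  rw [← integral_finsetSum _ fun n _ => H.integrableOn_offloadIntegrand n 0 hβ,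
    ← H.integral_integral_offload
      (integrable_finsetSum _ fun n _ => H.integrableOn_offloadIntegrand n 0 hβ)]
  simp_rw [S₂OC, offloadIntegrand, pow_zero, mul_one, ← Finset.sum_mul, tierTerm, balanceDist,
    one_mul]

/-- Nulling the interference of the nearest macro base station gains, for every `m < N₂`, the
`m`-th coverage term weighted by `(t / (1 + t)) ^ (N₂ - m)`. -/
lemma S₂OnonC_eq {β : ℝ} (hβ : 0 < β) : H.S₂OnonC β = H.S₂OC β
    - ∑ m ∈ Finset.range H.N₂,
        ∫ z in H.offloadRegion, H.offloadIntegrand m (H.N₂ - m) β z := by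
  have hi₁ : IntegrableOn (fun z => ∑ n ∈ Finset.range H.N₂, H.offloadIntegrand n 0 β z)
      H.offloadRegion :=
    integrable_finsetSum _ fun n _ => H.integrableOn_offloadIntegrand n 0 hβ
  have hi₂ : IntegrableOn
      (fun z => ∑ m ∈ Finset.range H.N₂, H.offloadIntegrand m (H.N₂ - m) β z) H.offloadRegion :=
    integrable_finsetSum _ fun m _ => H.integrableOn_offloadIntegrand m (H.N₂ - m) hβ
  let F : ℝ × ℝ → ℝ := fun z => (∑ n ∈ Finset.range H.N₂, 1 / (n.factorial : ℝ) *
        ∑ q ∈ Finset.Nat.antidiagonalTuple 3 n, (Nat.multinomial Finset.univ q : ℝ)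
          * laplaceDiff H.lam₁ H.α₁ (q 0) (β * z.2 ^ H.α₂ * (H.ρ₁ / H.ρ₂)) z.1
          * laplaceDiff H.lam₂ H.α₂ (q 1) (β * z.2 ^ H.α₂) z.2
          * Real.Gamma (q 2 + 1)
          * (β * H.offloadRatio z) ^ (q 2)
          * ((1 + β * H.offloadRatio z) ^ (q 2 + 1))⁻¹)
        * H.fY₁Y₂ z.1 z.2
  have hF : EqOn (fun z => ∑ n ∈ Finset.range H.N₂, H.offloadIntegrand n 0 β z
      - ∑ m ∈ Finset.range H.N₂, H.offloadIntegrand m (H.N₂ - m) β z) F H.offloadRegion := by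
    intro z hz
    have hr := H.offloadRatio_pos hz.1 (H.snd_pos_of_mem_offloadRegion hz)
    have ht : 1 + β * H.offloadRatio z ≠ 0 := by positivity
    have h := sum_sub_sum_multinomial
      (fun k => laplaceDiff H.lam₁ H.α₁ k (β * z.2 ^ H.α₂ * (H.ρ₁ / H.ρ₂)) z.1)
      (fun k => laplaceDiff H.lam₂ H.α₂ k (β * z.2 ^ H.α₂) z.2) ht H.N₂
    simp only [F, offloadIntegrand, pow_zero, mul_one, ← Finset.sum_mul, tierTerm]
    rw [← sub_mul, ← h, sub_sub_cancel]
  have hFi : IntegrableOn F H.offloadRegion :=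
    (hi₁.sub hi₂).congr_fun hF H.measurableSet_offloadRegion
  have e : H.S₂OnonC β = ∫ z in H.offloadRegion, F z := by
    rw [← H.integral_integral_offload hFi]
    simp_rw [S₂OnonC, F, offloadRatio, balanceDist, one_mul]
  rw [e, ← setIntegral_congr_fun H.measurableSet_offloadRegion hF, integral_sub hi₁ hi₂,
    H.S₂OC_eq hβ, integral_finsetSum _ fun n _ => H.integrableOn_offloadIntegrand n 0 hβ,
    integral_finsetSum _ fun m _ => H.integrableOn_offloadIntegrand m (H.N₂ - m) hβ]

/-- The gain of an offloaded user from interference nulling is of exact order `β ^ N₂`. -/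
lemma exists_tendsto_S₂OC_sub_S₂OnonC : ∃ c : ℝ, 0 < c ∧
    Tendsto (fun β => (H.S₂OC β - H.S₂OnonC β) / β ^ H.N₂) (𝓝[>] 0) (𝓝 c) := by
  choose c hc hlim using fun m => H.exists_tendsto_integral_offloadIntegrand m (H.N₂ - m)
  refine ⟨∑ m ∈ Finset.range H.N₂, c m, Finset.sum_pos (fun m _ => hc m)
    (Finset.nonempty_range_iff.2 H.N₂_pos.ne'), ?_⟩
  refine (tendsto_finsetSum (Finset.range H.N₂) fun m _ => hlim m).congr' ?_
  filter_upwards [self_mem_nhdsWithin] with β hβ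
  rw [H.S₂OnonC_eq hβ, sub_sub_cancel, Finset.sum_div]
  refine Finset.sum_congr rfl fun m hm => ?_
  rw [Nat.add_sub_cancel' (Finset.mem_range.1 hm).le]

lemma meanLoad₁_pos : 0 < H.meanLoad₁ := by
  have := H.A₁_pos
  have := H.lam₁_pos
  have := H.lamU_pos
  unfold meanLoad₁
  positivity

lemma meanLoad₂_pos : 0 < H.meanLoad₂ := by
  have := H.A₂_pos
  have := H.lam₂_pos
  have := H.lamU_pos
  unfold meanLoad₂
  positivity

end HetNet

theorem lemma1 (H : HetNet) (U : ℕ) (hU : 1 ≤ U) (hUN : U < H.N₁) :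
    ThetaAtZero (fun τ => H.ΔR₂O U τ) (fun τ => τ ^ H.N₂) ∧
      ThetaAtZero (fun τ => |H.ΔR₁ U τ|) (fun τ => τ ^ (H.N₁ - U)) := by
  obtain ⟨V, rfl⟩ : ∃ V, U = V + 1 := ⟨U - 1, by omega⟩
  have htail := H.tailActive_pos (V + 1)
  constructor
  · obtain ⟨c, hc, hlim⟩ := H.exists_tendsto_S₂OC_sub_S₂OnonC
    have hgain : 0 < H.tailActive (V + 1) / H.κ := div_pos htail H.κ_pos
    have h := HetNet.thetaAtZero_comp_sirThreshold (div_pos H.meanLoad₂_pos H.W_pos)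
      (mul_pos hgain hc) (g := fun β => H.tailActive (V + 1) / H.κ * (H.S₂OC β - H.S₂OnonC β))
      (n := H.N₂) (by simpa only [mul_div_assoc] using hlim.const_mul (H.tailActive (V + 1) / H.κ))
    convert h using 2 with τ
    rw [← H.probIN_succ_sub, HetNet.ΔR₂O, Nat.add_sub_cancel, HetNet.R₂O, HetNet.R₂O,
      HetNet.R₂OC, HetNet.R₂OnonC, div_mul_eq_mul_div]
    ring
  · obtain ⟨c, hc, hlim⟩ := H.exists_tendsto_integral_macroIntegrand (H.N₁ - (V + 1))
    have h := HetNet.thetaAtZero_comp_sirThreshold (div_pos H.meanLoad₁_pos H.W_pos)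
      (mul_pos htail hc) (g := fun β => |H.S₁ (V + 1) β - H.S₁ V β|) (n := H.N₁ - (V + 1)) (by
        have h2 := (hlim.abs).const_mul (H.tailActive (V + 1))
        rw [abs_of_pos hc] at h2
        refine h2.congr' ?_
        filter_upwards [self_mem_nhdsWithin] with β hβ
        have hβ : 0 < β := hβ
        rw [H.S₁_succ_sub hUN hβ, abs_neg, abs_mul, abs_div, abs_of_pos htail,
          abs_of_pos (pow_pos hβ _), mul_div_assoc])
    convert h using 2 with τ
    rw [HetNet.ΔR₁, Nat.add_sub_cancel, HetNet.R₁, HetNet.R₁, div_mul_eq_mul_div]
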